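/- Throughout, a \emph{graph} $\Gamma$ is either a finite connected multigraph without loop edges (whose points are its vertices) or a compact connected metric graph (with all its points); $g$ is its genus (first Betti number), $K_\Gamma$ its canonical divisor, $\sim$ linear equivalence of divisors and $r$ the Baker--Norine rank. Fix two points $v,w$ of $\Gamma$. A divisor $D$ is \emph{submodular} if $r(D')-r(D'-v)-r(D'-w)+r(D'-v-w)\ge 0$ for all $D'=D+av-bw$, $a,b\in\mathbb Z$. The \emph{transmission permutation} of $D$, if it exists, is the unique permutation $\tau^{v,w}_D$ of $\mathbb Z$ such that for all $a,b\in\mathbb Z$ $$r(D+av-bw)+1=\#\{n\ge b:\tau^{v,w}_D(n)\le a\},\qquad r(K_\Gamma-D-av+bw)+1=\#\{n<b:\tau^{v,w}_D(n)>a\}.$$ Let $\iota_m(n)=n-m$. For an integer $k\ge 0$, $k\ne 1$, let $\sigma^k_m$ be the permutation of $\mathbb Z$ exchanging $n$ and $n+1$ for all $n\equiv m\pmod k$ and fixing all other integers (for $k=0$ congruence means equality). Let $\widetilde\Sigma_0$ be the set of permutations of $\mathbb Z$ with finitely many inversions, and for $k\ge2$ let $\widetilde\Sigma_k$ be the set of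 permutations $\alpha$ of $\mathbb{Z}$ with $\alpha(n+k)=\alpha(n)+k$ for all $n$. For $\alpha\in\widetilde\Sigma_k$ let $\operatorname{inv}_k(\alpha)$ be the number of inversions of $\alpha$ up to simultaneous translation by multiples of $k$. For $k\ge0$, $k\neq1$, the twice-marked graph $(\Gamma,v,w)$ has \emph{$k$-general transmission} if every divisor $D$ on $\Gamma$ is submodular with $\tau^{v,w}_D\in\widetilde\Sigma_k$ and $\operatorname{inv}_k\tau^{v,w}_D\le g$. Its \emph{torsion order} is the integer $k\ge0$ such that $nv\sim nw$ if and only if $n\in k\mathbb Z$. \textbf{Theorem.} Let $(\Gamma,v,w)$ be a twice-marked graph of genus $1$ with $v\not\sim w$. (A) Suppose that $(\Gamma,v,w)$ has torsion order $k$, and let $D$ be a divisor of degree $d$ on $\Gamma$. Then $D$ is submodular; if $D\sim mw+(d-m)v$ for some $m\in\mathbb Z$, then $\tau^{v,w}_D=\iota_{d-1}\,\sigma^k_{m-1}$; and if there is no such $m$, then $\tau^{v,w}_D=\iota_{d-1}$. (B) For every integer $k\ge0$ with $k\ne1$, $(\Gamma,v,w)$ has $k$-general transmission if and only if it has torsion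 order $k$. -/

import Mathlib

open scoped Classical

universe u

noncomputable section

namespace Transmission

/-! ### Graphs -/

/-- A nonempty connected finite multigraph (parallel edges and loops allowed). Every edge is given an
arbitrary reference direction from `src` to `tgt`. -/
structure Multigraph where
  V : Type u
  E : Type u
  [fintypeV : Fintype V]
  [fintypeE : Fintype E]
  src : E → V
  tgt : E → V
  nonempty : Nonempty V
  connected : ∀ x y : V, Relation.EqvGen (fun a b => ∃ e, src e = a ∧ tgt e = b) x y

attribute [instance] Multigraph.fintypeV Multigraph.fintypeE

namespace Multigraph

/-- First Betti number `|E| - |V| + 1`; it is nonnegative because the graph is connected, so the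
subtraction of natural numbers does not truncate. -/
def genus (G : Multigraph.{u}) : ℕ := Fintype.card G.E + 1 - Fintype.card G.V

/-- Valence of a vertex; a loop counts twice. -/
def valence (G : Multigraph.{u}) (x : G.V) : ℕ :=
  Fintype.card {e : G.E // G.src e = x} + Fintype.card {e : G.E // G.tgt e = x}

end Multigraph

/-- A finite connected graph with no loop edges (parallel edges allowed). -/
structure FiniteGraph extends Multigraph.{u} where
  loopless : ∀ e, src e ≠ tgt e

namespace FiniteGraph

/-- The divisor of `f : V → ℤ`, evaluated at a vertex `x`: the sum over the edges at `x` of the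
outgoing increments of `f`. -/
def ord (G : FiniteGraph.{u}) (f : G.V → ℤ) (x : G.V) : ℤ :=
  ∑ e : G.E, ((if G.src e = x then f (G.tgt e) - f x else 0)
    + (if G.tgt e = x then f (G.src e) - f x else 0))

/-- A principal divisor: one obtained from `0` by chip-firing moves. -/
def IsPrincipal (G : FiniteGraph.{u}) (D : G.V →₀ ℤ) : Prop :=
  ∃ f : G.V → ℤ, ∀ x, D x = G.ord f x

/-- The canonical divisor `∑ (val x - 2) x`. -/
def canonical (G : FiniteGraph.{u}) : G.V →₀ ℤ :=
  ∑ x : G.V, Finsupp.single x ((G.valence x : ℤ) - 2)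

end FiniteGraph

/-- A compact connected metric graph, presented by a model: a connected finite multigraph with a
positive real length on every edge. -/
structure MetricGraph extends Multigraph.{u} where
  len : E → ℝ
  len_pos : ∀ e, 0 < len e

namespace MetricGraph

/-- The points of the metric graph: the vertices of the model, and the points in the interiors of
the edges, where `inner e t` is the point of `e` at distance `t` from `src e` along `e`. -/
inductive Point (Γ : MetricGraph.{u}) : Type u
  | vertex (x : Γ.V) : Point Γ
  | inner (e : Γ.E) (t : ℝ) (h0 : 0 < t) (h1 : t < Γ.len e) : Point Γ

/-- The parametrization `[0, len e] → Γ` of the closed edge `e` by arc length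
(extended by constants to all of `ℝ`). -/
def edgePoint (Γ : MetricGraph.{u}) (e : Γ.E) (t : ℝ) : Γ.Point :=
  if h0 : 0 < t then
    if h1 : t < Γ.len e then Point.inner e t h0 h1 else Point.vertex (Γ.tgt e)
  else Point.vertex (Γ.src e)

/-- Rational functions: continuous functions that are piecewise linear with integer slopes on every
edge, with finitely many pieces. (As the affine formula is required on the closed pieces `[x, y]`,
continuity is implied.) -/
def IsRational (Γ : MetricGraph.{u}) (f : Γ.Point → ℝ) : Prop :=
  ∀ e : Γ.E, ∃ S : Finset ℝ, ∀ x y : ℝ, 0 ≤ x → x < y → y ≤ Γ.len e →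
    (∀ s ∈ S, s ∉ Set.Ioo x y) →
      ∃ m : ℤ, ∀ t ∈ Set.Icc x y,
        f (Γ.edgePoint e t) = f (Γ.edgePoint e x) + m * (t - x)

/-- Slope of `f` at the point `t` of the edge `e`, in the direction of increasing `t`. -/
def slopeUp (Γ : MetricGraph.{u}) (f : Γ.Point → ℝ) (e : Γ.E) (t : ℝ) : ℝ :=
  derivWithin (fun s => f (Γ.edgePoint e s)) (Set.Ioi t) t

/-- Outgoing slope of `f` at the point `t` of the edge `e`, in the direction of decreasing `t`. -/
def slopeDown (Γ : MetricGraph.{u}) (f : Γ.Point → ℝ) (e : Γ.E) (t : ℝ) : ℝ :=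
  - derivWithin (fun s => f (Γ.edgePoint e s)) (Set.Iio t) t

/-- The order of `f` at a point: the sum of the outgoing slopes of `f` along all tangent
directions. -/
def ord (Γ : MetricGraph.{u}) (f : Γ.Point → ℝ) : Γ.Point → ℝ
  | Point.vertex x =>
      ∑ e : Γ.E, ((if Γ.src e = x then Γ.slopeUp f e 0 else 0)
        + (if Γ.tgt e = x then Γ.slopeDown f e (Γ.len e) else 0))
  | Point.inner e t _ _ => Γ.slopeUp f e t + Γ.slopeDown f e t

/-- A principal divisor: the divisor of a rational function. -/
def IsPrincipal (Γ : MetricGraph.{u}) (D : Γ.Point →₀ ℤ) : Prop :=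
  ∃ f : Γ.Point → ℝ, Γ.IsRational f ∧ ∀ p, (D p : ℝ) = Γ.ord f p

/-- The canonical divisor `∑ (val x - 2) x`. -/
def canonical (Γ : MetricGraph.{u}) : Γ.Point →₀ ℤ :=
  ∑ x : Γ.V, Finsupp.single (Point.vertex x) ((Γ.valence x : ℤ) - 2)

end MetricGraph

/-- "Graph" in the agnostic sense: either a finite connected loopless graph or a connected metric
graph. -/
inductive FinOrMetricGraph : Type (u + 1)
  | finite (G : FiniteGraph.{u}) : FinOrMetricGraph
  | metric (Γ : MetricGraph.{u}) : FinOrMetricGraph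

namespace FinOrMetricGraph

/-- Points: the vertices of a finite graph, all points of a metric graph. -/
def Point : FinOrMetricGraph.{u} → Type u
  | finite G => G.V
  | metric Γ => Γ.Point

def genus : FinOrMetricGraph.{u} → ℕ
  | finite G => G.toMultigraph.genus
  | metric Γ => Γ.toMultigraph.genus

/-- Divisors: finite `ℤ`-linear combinations of points. -/
abbrev Divisor (Γ : FinOrMetricGraph.{u}) : Type u := Γ.Point →₀ ℤ

def IsPrincipal : (Γ : FinOrMetricGraph.{u}) → Γ.Divisor → Prop
  | finite G => G.IsPrincipal
  | metric Γ => Γ.IsPrincipal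

def canonical : (Γ : FinOrMetricGraph.{u}) → Γ.Divisor
  | finite G => G.canonical
  | metric Γ => Γ.canonical

/-! ### Divisors, linear equivalence and rank -/

/-- The divisor consisting of the single point `p`. -/
def pt (Γ : FinOrMetricGraph.{u}) (p : Γ.Point) : Γ.Divisor := Finsupp.single p 1

def deg (Γ : FinOrMetricGraph.{u}) (D : Γ.Divisor) : ℤ := D.sum fun _ n => n

def LinEquiv (Γ : FinOrMetricGraph.{u}) (D D' : Γ.Divisor) : Prop := Γ.IsPrincipal (D - D')

/-- The Baker-Norine rank: the largest `r ≥ -1` such that `D - E` is linearly equivalent to an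
effective divisor for every effective divisor `E` of degree `r`. The condition is vacuous for
`r = -1` and fails for `r > max (Γ.deg D) (-1)`, so that the supremum is a maximum. -/
def rank (Γ : FinOrMetricGraph.{u}) (D : Γ.Divisor) : ℤ :=
  sSup {r : ℤ | -1 ≤ r ∧ ∀ E : Γ.Divisor, 0 ≤ E → Γ.deg E = r →
    ∃ F : Γ.Divisor, 0 ≤ F ∧ Γ.LinEquiv (D - E) F}

/-! ### Submodular divisors and transmission permutations -/

/-- `Δ(D) = r(D) - r(D - v) - r(D - w) + r(D - v - w)`. -/
def Delta (Γ : FinOrMetricGraph.{u}) (v w : Γ.Point) (D : Γ.Divisor) : ℤ :=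
  Γ.rank D - Γ.rank (D - Γ.pt v) - Γ.rank (D - Γ.pt w) + Γ.rank (D - Γ.pt v - Γ.pt w)

/-- `D` is submodular with respect to `v, w`. -/
def IsSubmodular (Γ : FinOrMetricGraph.{u}) (v w : Γ.Point) (D : Γ.Divisor) : Prop :=
  ∀ a b : ℤ, 0 ≤ Γ.Delta v w (D + a • Γ.pt v - b • Γ.pt w)

/-- `τ` is the transmission permutation of `D` on `(Γ, v, w)`. -/
def IsTransmissionPerm (Γ : FinOrMetricGraph.{u}) (v w : Γ.Point) (D : Γ.Divisor) (τ : Equiv.Perm ℤ) : Prop :=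
  ∀ a b : ℤ,
    ({n : ℤ | b ≤ n ∧ τ n ≤ a}.Finite ∧
      Γ.rank (D + a • Γ.pt v - b • Γ.pt w) + 1 = ({n : ℤ | b ≤ n ∧ τ n ≤ a}.ncard : ℤ)) ∧
    ({n : ℤ | n < b ∧ a < τ n}.Finite ∧
      Γ.rank (Γ.canonical - D - a • Γ.pt v + b • Γ.pt w) + 1 =
        ({n : ℤ | n < b ∧ a < τ n}.ncard : ℤ))

end FinOrMetricGraph

/-! ### Permutations of the integers -/

/-- The inversions of a permutation. -/
def Inversion (α : Equiv.Perm ℤ) : Type := {p : ℤ × ℤ // p.1 < p.2 ∧ α p.2 < α p.1}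

/-- The extended affine symmetric group of period `k` if `k ≥ 2`; for `k = 0`, the permutations with
finitely many inversions. The value at `k = 1` is never used. -/
def extAffine (k : ℕ) : Set (Equiv.Perm ℤ) :=
  {α | if k = 0 then Finite (Inversion α) else ∀ n : ℤ, α (n + k) = α n + k}

/-- The number of inversions of `α` up to simultaneous translation by multiples of `k`. -/
def invCount (k : ℕ) (α : Equiv.Perm ℤ) : ℕ∞ :=
  ENat.card (Quot fun p q : Inversion α =>
    ∃ n : ℤ, q.1.1 = p.1.1 + n * k ∧ q.1.2 = p.1.2 + n * k)

/-- The shift `ι_m (n) = n - m`. -/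
def shift (m : ℤ) : Equiv.Perm ℤ := Equiv.subRight m

/-- For `k ≠ 1`, the permutation `σ^k_m` exchanging `n` and `n + 1` for all `n ≡ m` modulo `k`
(equality if `k = 0`) and fixing all other integers. The value at `k = 1` is never used. -/
def simpleReflection (k : ℕ) (m : ℤ) : Equiv.Perm ℤ where
  toFun n := if n ≡ m [ZMOD k] then n + 1 else if n ≡ m + 1 [ZMOD k] then n - 1 else n
  invFun n := if n ≡ m + 1 [ZMOD k] then n - 1 else if n ≡ m [ZMOD k] then n + 1 else n
  left_inv n := by
    have e1 : (n + 1 ≡ m + 1 [ZMOD k]) ↔ n ≡ m [ZMOD k] := by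
      simp [Int.modEq_iff_dvd]
    have e2 : (n - 1 ≡ m [ZMOD k]) ↔ n ≡ m + 1 [ZMOD k] := by
      rw [Int.modEq_iff_dvd, Int.modEq_iff_dvd]; ring_nf
    dsimp only
    by_cases h : n ≡ m [ZMOD k]
    · simp [h, e1]
    · by_cases h' : n ≡ m + 1 [ZMOD k]
      · have h2 : ¬ n - 1 ≡ m + 1 [ZMOD k] := by
          intro h3
          apply h
          rw [Int.modEq_iff_dvd] at h' h3 ⊢
          have := dvd_sub (dvd_add h' h') h3
          ring_nf at this ⊢
          exact this
        simp [h, h', h2, e2]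
      · simp [h, h']
  right_inv n := by
    have e1 : (n + 1 ≡ m + 1 [ZMOD k]) ↔ n ≡ m [ZMOD k] := by
      simp [Int.modEq_iff_dvd]
    have e2 : (n - 1 ≡ m [ZMOD k]) ↔ n ≡ m + 1 [ZMOD k] := by
      rw [Int.modEq_iff_dvd, Int.modEq_iff_dvd]; ring_nf
    dsimp only
    by_cases h : n ≡ m + 1 [ZMOD k]
    · simp [h, e2]
    · by_cases h' : n ≡ m [ZMOD k]
      · have h2 : ¬ n + 1 ≡ m [ZMOD k] := by
          intro h3
          apply h
          rw [Int.modEq_iff_dvd] at h' h3 ⊢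
          have := dvd_sub (dvd_add h' h') h3
          ring_nf at this ⊢
          exact this
        simp [h, h', h2, e1]
      · simp [h, h']

namespace FinOrMetricGraph

/-! ### Torsion order and general transmission -/

/-- `k` is the torsion order of `(Γ, v, w)`: `n v ∼ n w` if and only if `n ∈ k ℤ`. -/
def IsTorsionOrder (Γ : FinOrMetricGraph.{u}) (v w : Γ.Point) (k : ℕ) : Prop :=
  ∀ n : ℤ, Γ.LinEquiv (n • Γ.pt v) (n • Γ.pt w) ↔ (k : ℤ) ∣ n

/-- `(Γ, v, w)` has `k`-general transmission (meaningful for `k ≠ 1`): every divisor is submodular,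
and its transmission permutation lies in `extAffine k` and has at most `g` inversions up to
translation by multiples of `k`. -/
def HasGeneralTransmission (Γ : FinOrMetricGraph.{u}) (v w : Γ.Point) (k : ℕ) : Prop :=
  ∀ D : Γ.Divisor, Γ.IsSubmodular v w D ∧
    ∃ τ : Equiv.Perm ℤ, Γ.IsTransmissionPerm v w D τ ∧ τ ∈ extAffine k ∧
      invCount k τ ≤ (Γ.genus : ℕ∞)

end FinOrMetricGraph

end Transmission

end

noncomputable section

namespace Transmission

namespace Multigraph

/-! ### Orientations of unicyclic graphs -/

/-! On a graph of genus one everything follows from two facts: a divisor of degree one is equivalent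
to a point, and the canonical divisor is principal. Together with `v ≁ w` the first gives
`rank_add_one`: `r(D) + 1` is `max (deg D) 0`, except that it is `1` when `D ∼ 0`. So ranks of
twists of `D` depend only on degrees and on the set of `b` with `D ∼ b w + (d - b) v`, which is
empty or a residue class modulo the torsion order. A permutation that, up to the shift `ι_{d-1}`,
exchanges `b - 1` and `b` for exactly these `b` has the same counts (`IsNearIdentity.count_ge`,
`IsNearIdentity.count_lt`), and `K ∼ 0` turns the second family of ranks into the first with the
degree negated. The counts determine the permutation (`perm_eq_of_ncard_eq`).

For general transmission, the inversions of such a permutation are the exchanged adjacent pairs,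
which form one class under translation by the torsion order. Conversely, the permutation of the zero
divisor already recovers the torsion order from periodicity and the bound by one inversion class
(`eq_of_reflection_mem_extAffine`).

Both geometric facts are proved at once for finite and metric graphs through `EdgeModel`. As `|E| =
|V|`, Hall's theorem orients the graph with one edge leaving each vertex, so all orbits flow into a
single cycle. A chain of segments prescribes slopes, and it integrates to a function as soon as its
holonomy, the signed length around the cycle, vanishes; the divisor of that function is the boundary
of the chain. Holonomy can be corrected by full turns of the cycle, which have no boundary, and by
moving a point along the cycle. -/

/-- This is Hall's condition for a proper subset `A`. A function supported on `A` is determined by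
its differences along the edges meeting `A`: if they vanish it is constant by connectedness, hence
equal to its value `0` at `x₀`. Comparing dimensions gives the bound. -/
theorem card_le_card_incident (G : Multigraph.{u}) (A : Finset G.V) (x₀ : G.V) (hx₀ : x₀ ∉ A) :
    A.card ≤ (A.biUnion fun x =>
      Finset.univ.filter fun e => G.src e = x ∨ G.tgt e = x).card := by
  set T := A.biUnion fun x => Finset.univ.filter fun e => G.src e = x ∨ G.tgt e = x with hT
  have memT : ∀ e, e ∈ T ↔ G.src e ∈ A ∨ G.tgt e ∈ A := by
    intro e
    simp only [hT, Finset.mem_biUnion, Finset.mem_filter, Finset.mem_univ, true_and]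
    constructor
    · rintro ⟨x, hx, rfl | rfl⟩ <;> tauto
    · rintro (h | h)
      · exact ⟨_, h, Or.inl rfl⟩
      · exact ⟨_, h, Or.inr rfl⟩
  let ext : (A → ℚ) → G.V → ℚ := fun g x => if h : x ∈ A then g ⟨x, h⟩ else 0
  let L : (A → ℚ) →ₗ[ℚ] (T → ℚ) :=
    { toFun := fun g e => ext g (G.tgt e.1) - ext g (G.src e.1)
      map_add' := by
        intro g g'
        funext e
        simp only [ext, Pi.add_apply]
        split_ifs <;> ring
      map_smul' := by
        intro a g
        funext e
        simp only [ext, Pi.smul_apply, smul_eq_mul, RingHom.id_apply]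
        split_ifs <;> ring }
  have hL : Function.Injective L := by
    rw [injective_iff_map_eq_zero]
    intro g hg
    have key : ∀ e, ext g (G.src e) = ext g (G.tgt e) := by
      intro e
      by_cases he : e ∈ T
      · have := congrFun hg ⟨e, he⟩
        simp only [L, LinearMap.coe_mk, AddHom.coe_mk, Pi.zero_apply] at this
        linarith
      · rw [memT, not_or] at he
        simp [ext, he.1, he.2]
    have hconst : ∀ x y, Relation.EqvGen (fun a b => ∃ e, G.src e = a ∧ G.tgt e = b) x y →
        ext g x = ext g y := by
      intro x y h
      induction h with
      | rel _ _ h => obtain ⟨e, rfl, rfl⟩ := h; exact key e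
      | refl => rfl
      | symm _ _ _ ih => exact ih.symm
      | trans _ _ _ _ _ ih ih' => exact ih.trans ih'
    funext x
    have := hconst x x₀ (G.connected _ _)
    simpa [ext, hx₀] using this
  have := LinearMap.finrank_le_finrank_of_injective hL
  simpa using this

/-- An orientation of the graph in which every vertex has exactly one outgoing edge. -/
structure UnicyclicOrientation (G : Multigraph.{u}) where
  edge : G.V ≃ G.E
  next : G.V → G.V
  ends : ∀ x, (G.src (edge x) = x ∧ G.tgt (edge x) = next x) ∨
    (G.tgt (edge x) = x ∧ G.src (edge x) = next x)

/-- Hall's theorem assigns distinct incident edges to the vertices, and the equality of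
cardinalities makes the assignment bijective. -/
theorem exists_unicyclicOrientation (G : Multigraph.{u})
    (h : Fintype.card G.E = Fintype.card G.V) : Nonempty G.UnicyclicOrientation := by
  obtain ⟨f, hf, hfi⟩ := (Finset.all_card_le_biUnion_card_iff_exists_injective
    (fun x : G.V => Finset.univ.filter fun e => G.src e = x ∨ G.tgt e = x)).1 (by
      intro A
      by_cases hA : A = Finset.univ
      · have : (A.biUnion fun x => Finset.univ.filter fun e => G.src e = x ∨ G.tgt e = x)
            = Finset.univ := by
          ext e
          simp [hA]
        rw [this, Finset.card_univ, h, hA, Finset.card_univ]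
      · obtain ⟨x₀, hx₀⟩ : ∃ x, x ∉ A := by
          by_contra! hc
          exact hA (Finset.eq_univ_iff_forall.2 hc)
        exact G.card_le_card_incident A x₀ hx₀)
  have hb : Function.Bijective f :=
    (Fintype.bijective_iff_injective_and_card f).2 ⟨hf, h.symm⟩
  refine ⟨⟨Equiv.ofBijective f hb,
    fun x => if G.src (f x) = x then G.tgt (f x) else G.src (f x), fun x => ?_⟩⟩
  have := hfi x
  simp only [Finset.mem_filter, Finset.mem_univ, true_and] at this
  by_cases hx : G.src (f x) = x
  · left; simp [hx]
  · right
    simpa [hx] using this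

/-- Every edge joins some `x` to `next x`, so by connectedness any two orbits merge; finiteness
makes some orbit point periodic, and all orbits then run into its cycle. -/
theorem UnicyclicOrientation.exists_root {G : Multigraph.{u}} (O : G.UnicyclicOrientation) :
    ∃ c, c ∈ Function.periodicPts O.next ∧ ∀ x, ∃ k, O.next^[k] x = c := by
  have join : ∀ x y, ∃ i j, O.next^[i] x = O.next^[j] y := by
    intro x y
    have h := G.connected x y
    induction h with
    | rel _ _ h =>
      obtain ⟨e, rfl, rfl⟩ := h
      obtain ⟨x, rfl⟩ := O.edge.surjective e
      rcases O.ends x with h | h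
      · exact ⟨1, 0, by simp [h.1, h.2]⟩
      · exact ⟨0, 1, by simp [h.1, h.2]⟩
    | refl => exact ⟨0, 0, rfl⟩
    | symm _ _ _ ih => obtain ⟨i, j, h⟩ := ih; exact ⟨j, i, h.symm⟩
    | trans _ _ _ _ _ ih ih' =>
      obtain ⟨i, j, h⟩ := ih
      obtain ⟨i', j', h'⟩ := ih'
      refine ⟨i' + i, j + j', ?_⟩
      rw [Function.iterate_add_apply, h, Function.iterate_add_apply, ← h',
        ← Function.iterate_add_apply, ← Function.iterate_add_apply, add_comm]
  obtain ⟨x₀⟩ := G.nonempty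
  obtain ⟨i, j, hij, he⟩ : ∃ i j, i < j ∧ O.next^[i] x₀ = O.next^[j] x₀ := by
    obtain ⟨i, j, hne, he⟩ := Finite.exists_ne_map_eq_of_infinite (fun n : ℕ => O.next^[n] x₀)
    rcases lt_or_gt_of_ne hne with h | h
    · exact ⟨i, j, h, he⟩
    · exact ⟨j, i, h, he.symm⟩
  have hper : Function.IsPeriodicPt O.next (j - i) (O.next^[i] x₀) := by
    rw [Function.IsPeriodicPt, Function.IsFixedPt, ← Function.iterate_add_apply,
      Nat.sub_add_cancel hij.le, he]
  refine ⟨O.next^[i] x₀, ⟨j - i, Nat.sub_pos_of_lt hij, hper⟩, fun x => ?_⟩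
  obtain ⟨a, b, hab⟩ := join x (O.next^[i] x₀)
  -- The orbit of `x` meets the cycle `b` steps after `c`; advancing until the total is a multiple
  -- of the period `j - i` lands on `c` itself.
  have hb : b ≤ (j - i) * b := Nat.le_mul_of_pos_left b (Nat.sub_pos_of_lt hij)
  refine ⟨((j - i) * b - b) + a, ?_⟩
  rw [Function.iterate_add_apply, hab, ← Function.iterate_add_apply, Nat.sub_add_cancel hb]
  exact (hper.mul_const b)

end Multigraph

/-- The cohomological equation over a self-map all of whose orbits reach the periodic point `c`. -/
theorem exists_potential {V : Type*} (p : V → V) (c : V) (hper : c ∈ Function.periodicPts p)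
    (hreach : ∀ x, ∃ k, p^[k] x = c) (δ : V → ℝ)
    (h0 : ∑ i ∈ Finset.range (Function.minimalPeriod p c), δ (p^[i] c) = 0) :
    ∃ h : V → ℝ, (∀ x, h (p x) - h x = δ x) ∧
      ∀ Λ : AddSubgroup ℝ, (∀ x, δ x ∈ Λ) → ∀ x, h x ∈ Λ := by
  let k : V → ℕ := fun x => Nat.find (hreach x)
  have hk : ∀ x, p^[k x] x = c := fun x => Nat.find_spec (hreach x)
  have hmin : ∀ x j, p^[j] x = c → k x ≤ j := fun x j hj => Nat.find_min' _ hj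
  -- The potential is normalised to `0` at `c` and summed along the orbit up to the first visit to
  -- `c`. The equation telescopes except at `c`, where the two sides differ by the sum over a whole
  -- period; only there is `h0` needed.
  refine ⟨fun x => - ∑ i ∈ Finset.range (k x), δ (p^[i] x), fun x => ?_, fun Λ hΛ x => ?_⟩
  · have step : ∀ n, ∑ i ∈ Finset.range (n + 1), δ (p^[i] x)
        = ∑ i ∈ Finset.range n, δ (p^[i] (p x)) + δ x := by
      intro n
      rw [Finset.sum_range_succ']
      simp
    by_cases hx : x = c
    · subst hx
      have hkx : k x = 0 := Nat.le_zero.1 (hmin x 0 rfl)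
      have hpos := Function.minimalPeriod_pos_of_mem_periodicPts hper
      have hkp : k (p x) + 1 = Function.minimalPeriod p x := by
        apply le_antisymm
        · have : k (p x) ≤ Function.minimalPeriod p x - 1 := by
            apply hmin
            rw [← Function.iterate_succ_apply, Nat.succ_eq_add_one, Nat.sub_add_cancel hpos]
            exact Function.isPeriodicPt_minimalPeriod p x
          omega
        · apply Function.IsPeriodicPt.minimalPeriod_le (Nat.succ_pos _)
          exact hk (p x)
      rw [← hkp, step] at h0
      simp only [hkx, Finset.range_zero, Finset.sum_empty]
      linarith
    · have hkx : k x = k (p x) + 1 := by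
        apply le_antisymm
        · exact hmin _ _ (hk (p x))
        · have hne : k x ≠ 0 := fun h => hx (by simpa [h] using hk x)
          obtain ⟨j, hj⟩ := Nat.exists_eq_succ_of_ne_zero hne
          have := hmin (p x) j (by
            have := hk x
            rwa [hj] at this)
          omega
      show -(∑ i ∈ Finset.range (k (p x)), δ (p^[i] (p x))) -
        -(∑ i ∈ Finset.range (k x), δ (p^[i] x)) = δ x
      rw [hkx, step]
      ring
  · exact Λ.neg_mem (Λ.sum_mem fun i _ => hΛ _)

/-! ### Divisors of degree one and the canonical divisor on unicyclic graphs -/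

/-- Edge parametrizations of a graph together with the principal divisors that are boundaries of
slope functions integrating to a potential on the vertices. The lengths and positions lie in a
subgroup `Λ` of the reals, which is `ℤ` for finite graphs. -/
structure EdgeModel (G : Multigraph.{u}) (P : Type u) where
  len : G.E → ℝ
  len_pos : ∀ e, 0 < len e
  Λ : AddSubgroup ℝ
  len_mem : ∀ e, len e ∈ Λ
  vert : G.V → P
  ep : G.E → ℝ → P
  ep_zero : ∀ e, ep e 0 = vert (G.src e)
  ep_len : ∀ e, ep e (len e) = vert (G.tgt e)
  exists_eq : ∀ z, (∃ x, z = vert x) ∨ ∃ e t, t ∈ Λ ∧ 0 ≤ t ∧ t ≤ len e ∧ z = ep e t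
  prin : AddSubgroup (P →₀ ℤ)
  mem_prin : ∀ (h : G.V → ℝ), (∀ x, h x ∈ Λ) → ∀ w : (G.E × ℝ) →₀ ℤ,
    (∀ q ∈ w.support, q.2 ∈ Λ ∧ 0 ≤ q.2 ∧ q.2 ≤ len q.1) →
    (∀ e, h (G.tgt e) - h (G.src e) =
      w.sum fun q n => n • (Pi.single q.1 (len q.1 - q.2) : G.E → ℝ) e) →
    (w.sum fun q n =>
      n • (Finsupp.single (ep q.1 q.2) (1 : ℤ) - Finsupp.single (vert (G.tgt q.1)) 1)) ∈ prin

namespace EdgeModel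

variable {G : Multigraph.{u}} {P : Type u} (M : EdgeModel G P)

/-- The boundary of a combination of terminal segments `[t, len e]` of edges. -/
def boundary : ((G.E × ℝ) →₀ ℤ) →+ (P →₀ ℤ) :=
  Finsupp.liftAddHom fun q => zmultiplesHom _
    (Finsupp.single (M.ep q.1 q.2) (1 : ℤ) - Finsupp.single (M.vert (G.tgt q.1)) 1)

/-- The signed length of a combination of terminal segments on each edge. -/
def increment : ((G.E × ℝ) →₀ ℤ) →+ (G.E → ℝ) :=
  Finsupp.liftAddHom fun q => zmultiplesHom _ (Pi.single q.1 (M.len q.1 - q.2))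

/-- Combinations of terminal segments that start at admissible positions. -/
def valid : Submodule ℤ ((G.E × ℝ) →₀ ℤ) :=
  Finsupp.supported ℤ ℤ {q | q.2 ∈ M.Λ ∧ 0 ≤ q.2 ∧ q.2 ≤ M.len q.1}

theorem boundary_single (q : G.E × ℝ) : M.boundary (Finsupp.single q 1) =
    Finsupp.single (M.ep q.1 q.2) (1 : ℤ) - Finsupp.single (M.vert (G.tgt q.1)) 1 := by
  simp [boundary]

theorem increment_single (q : G.E × ℝ) : M.increment (Finsupp.single q 1) =
    Pi.single q.1 (M.len q.1 - q.2) := by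
  simp [increment]

theorem single_mem_valid {e : G.E} {t : ℝ} (h : t ∈ M.Λ) (h0 : 0 ≤ t) (h1 : t ≤ M.len e) :
    Finsupp.single (e, t) 1 ∈ M.valid :=
  Finsupp.single_mem_supported ℤ 1 (show (e, t) ∈ {_q : G.E × ℝ | _} from ⟨h, h0, h1⟩)

theorem increment_mem {w : (G.E × ℝ) →₀ ℤ} (hw : w ∈ M.valid) (e : G.E) :
    M.increment w e ∈ M.Λ := by
  have hw' := (Finsupp.mem_supported ℤ w).1 hw
  simp only [increment, Finsupp.liftAddHom_apply, Finsupp.sum, Finset.sum_apply,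
    zmultiplesHom_apply, Pi.smul_apply]
  refine M.Λ.sum_mem fun q hq => M.Λ.zsmul_mem ?_ _
  rw [Pi.single_apply]
  split_ifs
  · exact M.Λ.sub_mem (M.len_mem _) (hw' hq).1
  · exact M.Λ.zero_mem

theorem boundary_mem_prin {w : (G.E × ℝ) →₀ ℤ} (hw : w ∈ M.valid) (h : G.V → ℝ)
    (hΛ : ∀ x, h x ∈ M.Λ)
    (hh : ∀ e, h (G.tgt e) - h (G.src e) = M.increment w e) : M.boundary w ∈ M.prin := by
  have := M.mem_prin h hΛ w (fun _ hq => (Finsupp.mem_supported ℤ w).1 hw hq) (by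
    intro e
    rw [hh]
    simp [increment, Finsupp.sum])
  exact this

/-! ### Chains along a unicyclic orientation and their holonomy. -/

variable (O : G.UnicyclicOrientation)

/-- Whether the reference direction of the edge leaving `x` points away from `x`. -/
def Forward (x : G.V) : Prop := G.src (O.edge x) = x ∧ G.tgt (O.edge x) = O.next x

/-- The segment from the point at distance `t` from `x` to the end of the edge leaving `x`. -/
def segment (x : G.V) (t : ℝ) : (G.E × ℝ) →₀ ℤ :=
  if Forward O x then Finsupp.single (O.edge x, t) 1
  -- When the edge is traversed against its reference direction, the segment is minus the initial
  -- piece `[0, len - t]`, written as a difference of terminal segments.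
  else Finsupp.single (O.edge x, M.len (O.edge x) - t) 1 - Finsupp.single (O.edge x, 0) 1

/-- The point at distance `t` from `x` along the edge leaving `x`. -/
def pos (x : G.V) (t : ℝ) : P :=
  if Forward O x then M.ep (O.edge x) t else M.ep (O.edge x) (M.len (O.edge x) - t)

theorem pos_zero (x : G.V) : M.pos O x 0 = M.vert x := by
  unfold pos
  split_ifs with h
  · rw [M.ep_zero, h.1]
  · rw [sub_zero, M.ep_len, ((O.ends x).resolve_left h).1]

theorem exists_pos (z : P) : ∃ x t, t ∈ M.Λ ∧ 0 ≤ t ∧ t ≤ M.len (O.edge x) ∧ z = M.pos O x t := by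
  rcases M.exists_eq z with ⟨x, rfl⟩ | ⟨e, t, ht, h0, h1, rfl⟩
  · exact ⟨x, 0, M.Λ.zero_mem, le_rfl, (M.len_pos _).le, (M.pos_zero O x).symm⟩
  · obtain ⟨x, rfl⟩ := O.edge.surjective e
    by_cases h : Forward O x
    · exact ⟨x, t, ht, h0, h1, by simp [pos, h]⟩
    · exact ⟨x, M.len _ - t, M.Λ.sub_mem (M.len_mem _) ht, by linarith, by linarith,
        by simp [pos, h]⟩

theorem segment_mem {x : G.V} {t : ℝ} (h : t ∈ M.Λ) (h0 : 0 ≤ t) (h1 : t ≤ M.len (O.edge x)) :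
    M.segment O x t ∈ M.valid := by
  unfold segment
  split_ifs
  · exact M.single_mem_valid h h0 h1
  · exact sub_mem (M.single_mem_valid (M.Λ.sub_mem (M.len_mem _) h) (by linarith) (by linarith))
      (M.single_mem_valid M.Λ.zero_mem le_rfl (M.len_pos _).le)

theorem segment_zero_mem (x : G.V) : M.segment O x 0 ∈ M.valid :=
  M.segment_mem O M.Λ.zero_mem le_rfl (M.len_pos _).le

theorem boundary_segment (x : G.V) (t : ℝ) : M.boundary (M.segment O x t) =
    Finsupp.single (M.pos O x t) 1 - Finsupp.single (M.vert (O.next x)) 1 := by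
  unfold segment pos
  split_ifs with h
  · rw [boundary_single, h.2]
  · rw [map_sub, boundary_single, boundary_single]
    simp only
    rw [M.ep_zero, ((O.ends x).resolve_left h).2]
    abel

/-- The length of `w` on the edge leaving `x`, in the direction away from `x`. -/
def drop (x : G.V) : ((G.E × ℝ) →₀ ℤ) →+ ℝ :=
  if Forward O x then (Pi.evalAddMonoidHom _ (O.edge x)).comp M.increment
  else -(Pi.evalAddMonoidHom _ (O.edge x)).comp M.increment

theorem drop_segment (x y : G.V) (t : ℝ) : M.drop O x (M.segment O y t) =
    if x = y then M.len (O.edge y) - t else 0 := by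
  by_cases h : x = y
  · subst h
    rw [if_pos rfl]
    unfold drop segment
    split_ifs <;> simp [increment_single]
  · unfold drop segment
    split_ifs <;> simp [increment_single, h]

/-- Integrating the slopes to a potential is a cohomological equation for `next`, so the only
obstruction is the total drop around the cycle. -/
theorem boundary_mem_prin_of_sum_drop {c : G.V} (hper : c ∈ Function.periodicPts O.next)
    (hreach : ∀ x, ∃ k, O.next^[k] x = c) {w : (G.E × ℝ) →₀ ℤ} (hw : w ∈ M.valid)
    (h0 : ∑ i ∈ Finset.range (Function.minimalPeriod O.next c),
      M.drop O (O.next^[i] c) w = 0) : M.boundary w ∈ M.prin := by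
  obtain ⟨h, hh, hΛ⟩ := exists_potential O.next c hper hreach (fun x => M.drop O x w) h0
  refine M.boundary_mem_prin hw h (hΛ M.Λ fun x => ?_) fun e => ?_
  · unfold drop
    split_ifs
    · exact M.increment_mem hw _
    · exact M.Λ.neg_mem (M.increment_mem hw _)
  · obtain ⟨x, rfl⟩ := O.edge.surjective e
    have hx := hh x
    unfold drop at hx
    split_ifs at hx with hf
    · rw [hf.1, hf.2, hx]; rfl
    · have := (O.ends x).resolve_left hf
      rw [this.1, this.2, ← neg_sub, hx]
      simp

/-- The length of `w` along the cycle through `c`. -/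
def holonomy (c : G.V) : ((G.E × ℝ) →₀ ℤ) →+ ℝ :=
  ∑ i ∈ Finset.range (Function.minimalPeriod O.next c), M.drop O (O.next^[i] c)

theorem holonomy_apply (c : G.V) (w) : M.holonomy O c w =
    ∑ i ∈ Finset.range (Function.minimalPeriod O.next c), M.drop O (O.next^[i] c) w := by
  simp [holonomy]

theorem holonomy_mem (c : G.V) {w} (hw : w ∈ M.valid) : M.holonomy O c w ∈ M.Λ := by
  rw [holonomy_apply]
  refine M.Λ.sum_mem fun i _ => ?_
  unfold drop
  split_ifs
  · exact M.increment_mem hw _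
  · exact M.Λ.neg_mem (M.increment_mem hw _)

theorem holonomy_segment {c : G.V} (hper : c ∈ Function.periodicPts O.next) (j : ℕ) (t : ℝ) :
    M.holonomy O c (M.segment O (O.next^[j] c) t) = M.len (O.edge (O.next^[j] c)) - t := by
  have hpos := Function.minimalPeriod_pos_of_mem_periodicPts hper
  rw [← Function.iterate_mod_minimalPeriod_eq (f := O.next) (x := c) (n := j), holonomy_apply]
  have hj := Nat.mod_lt j hpos
  rw [Finset.sum_eq_single (j % Function.minimalPeriod O.next c)]
  · simp [drop_segment]
  · intro i hi hne
    rw [drop_segment, if_neg]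
    intro h
    exact hne (Function.iterate_injOn_Iio_minimalPeriod (Finset.mem_range.1 hi) hj h)
  · intro h
    exact absurd (Finset.mem_range.2 hj) h

/-- The sum of the first `k` edges of the orbit of `x`. -/
def path (x : G.V) (k : ℕ) : (G.E × ℝ) →₀ ℤ :=
  ∑ i ∈ Finset.range k, M.segment O (O.next^[i] x) 0

theorem path_mem (x : G.V) (k : ℕ) : M.path O x k ∈ M.valid :=
  sum_mem fun _ _ => M.segment_zero_mem O _

theorem boundary_path (x : G.V) (k : ℕ) : M.boundary (M.path O x k) =
    Finsupp.single (M.vert x) 1 - Finsupp.single (M.vert (O.next^[k] x)) 1 := by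
  induction k with
  | zero => simp [path]
  | succ k ih =>
    rw [path, Finset.sum_range_succ, map_add, ← path, ih, boundary_segment, pos_zero,
      Function.iterate_succ_apply']
    abel

/-- The point `z` lies at distance `R` before the end of a walk on the cycle: either `z` is already
on the walk from `next x`, or it is on the first edge, at distance `S + len - R` from `x`. -/
theorem exists_of_le_length {c : G.V} (hper : c ∈ Function.periodicPts O.next) {R : ℝ}
    (hR : R ∈ M.Λ) (h0 : 0 < R) (k : ℕ) : ∀ x, (∃ j, O.next^[j] c = x) →
    R ≤ ∑ i ∈ Finset.range k, M.len (O.edge (O.next^[i] x)) →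
    ∃ w ∈ M.valid, ∃ z, M.holonomy O c w = R ∧ M.boundary w =
      Finsupp.single z 1 - Finsupp.single (M.vert (O.next^[k] x)) 1 := by
  induction k with
  | zero => intro x _ hx; simp at hx; linarith
  | succ k ih =>
    intro x hxc hx
    have hnext : ∃ j, O.next^[j] c = O.next x := by
      obtain ⟨j, rfl⟩ := hxc
      exact ⟨j + 1, Function.iterate_succ_apply' _ _ _⟩
    rw [Finset.sum_range_succ'] at hx
    simp only [Function.iterate_succ_apply, Function.iterate_zero, id_eq] at hx ⊢
    set S := ∑ i ∈ Finset.range k, M.len (O.edge (O.next^[i] (O.next x))) with hS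
    by_cases hle : R ≤ S
    · exact ih _ hnext hle
    · have hSΛ : S ∈ M.Λ := M.Λ.sum_mem fun _ _ => M.len_mem _
      refine ⟨M.segment O x (S + M.len (O.edge x) - R) + M.path O (O.next x) k,
        add_mem (M.segment_mem O (M.Λ.sub_mem (M.Λ.add_mem hSΛ (M.len_mem _)) hR)
          (by linarith) (by linarith)) (M.path_mem O _ _),
        M.pos O x (S + M.len (O.edge x) - R), ?_, ?_⟩
      · have hp : M.holonomy O c (M.path O (O.next x) k) = S := by
          obtain ⟨j, hj⟩ := hnext
          rw [path, map_sum, hS, ← hj]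
          refine Finset.sum_congr rfl fun i _ => ?_
          rw [← Function.iterate_add_apply, M.holonomy_segment O hper, sub_zero]
        obtain ⟨j, rfl⟩ := hxc
        rw [map_add, hp, holonomy_segment M O hper]
        ring
      · rw [map_add, boundary_segment, boundary_path]
        abel

/-- Each point is transported to `c` along the orientation. -/
theorem exists_boundary_eq {c : G.V} (hreach : ∀ x, ∃ k, O.next^[k] x = c) (D : P →₀ ℤ) :
    ∃ w ∈ M.valid, M.boundary w =
      D - (D.sum fun _ n => n) • Finsupp.single (M.vert c) 1 := by
  induction D using Finsupp.induction_linear with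
  | zero => exact ⟨0, zero_mem _, by simp⟩
  | add D D' ih ih' =>
    obtain ⟨w, hw, h⟩ := ih
    obtain ⟨w', hw', h'⟩ := ih'
    refine ⟨w + w', add_mem hw hw', ?_⟩
    rw [map_add, h, h', Finsupp.sum_add_index' (fun _ => rfl) (fun _ _ _ => rfl), add_smul]
    abel
  | single z n =>
    obtain ⟨x, t, ht, h0, h1, rfl⟩ := M.exists_pos O z
    obtain ⟨k, hk⟩ := hreach (O.next x)
    refine ⟨n • (M.segment O x t + M.path O (O.next x) k), M.valid.smul_mem _
      (add_mem (M.segment_mem O ht h0 h1) (M.path_mem O _ _)), ?_⟩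
    rw [map_zsmul, map_add, boundary_segment, boundary_path, hk, Finsupp.sum_single_index rfl,
      sub_add_sub_cancel, smul_sub]
    simp

/-- A chain from `c` to `D` and a chain from `c` to a suitable cycle point `z` have the same
holonomy, so their difference bounds `D - z` and integrates. -/
theorem exists_point_of_degree_one (hG : Fintype.card G.E = Fintype.card G.V) (D : P →₀ ℤ)
    (hD : (D.sum fun _ n => n) = 1) : ∃ z, D - Finsupp.single z 1 ∈ M.prin := by
  obtain ⟨O⟩ := G.exists_unicyclicOrientation hG
  obtain ⟨c, hper, hreach⟩ := O.exists_root
  obtain ⟨w, hw, hb⟩ := M.exists_boundary_eq O hreach D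
  rw [hD, one_smul] at hb
  set n := Function.minimalPeriod O.next c with hn
  have hpos : 0 < n := Function.minimalPeriod_pos_of_mem_periodicPts hper
  have hnc : O.next^[n] c = c := Function.isPeriodicPt_minimalPeriod O.next c
  set L := ∑ i ∈ Finset.range n, M.len (O.edge (O.next^[i] c)) with hL
  have hLpos : 0 < L := Finset.sum_pos (fun _ _ => M.len_pos _) ⟨0, by simpa using hpos⟩
  have hLh : M.holonomy O c (M.path O c n) = L := by
    rw [path, map_sum]
    exact Finset.sum_congr rfl fun i _ => by rw [M.holonomy_segment O hper, sub_zero]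
  -- Removing full turns, which have zero boundary, brings the holonomy into `(0, L]`, the range
  -- realised by a point within one turn before `c`.
  obtain ⟨m, ⟨hm0, hm1⟩, -⟩ := existsUnique_sub_zsmul_mem_Ioc hLpos (M.holonomy O c w) 0
  have hR : M.holonomy O c w - m • L = M.holonomy O c (w - m • M.path O c n) := by
    rw [map_sub, map_zsmul, hLh]
  have hw' : w - m • M.path O c n ∈ M.valid := sub_mem hw (M.valid.smul_mem _ (M.path_mem O _ _))
  obtain ⟨w₁, hw₁, z, h1, h2⟩ := M.exists_of_le_length O hper
    (R := M.holonomy O c w - m • L) (by rw [hR]; exact M.holonomy_mem O c hw')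
    hm0 n c ⟨0, rfl⟩ (by simpa using hm1)
  refine ⟨z, ?_⟩
  have := M.boundary_mem_prin_of_sum_drop O hper hreach (sub_mem hw' hw₁) (by
    rw [← holonomy_apply, map_sub, h1, hR, sub_self])
  rw [map_sub, map_sub, map_zsmul, boundary_path, hb, h2] at this
  simp only [hnc, sub_self, smul_zero, sub_zero] at this
  convert this using 1
  abel

/-- Each edge is `x → next x` for exactly one `x`, so counting ends turns the canonical divisor into
`∑ (next x - x)`. This is minus the boundary of the sum of all edges, whose holonomy is one full
turn; adding the cycle cancels the holonomy without changing the boundary. -/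
theorem canonical_mem_prin (hG : Fintype.card G.E = Fintype.card G.V) :
    ∑ x : G.V, Finsupp.single (M.vert x) ((G.valence x : ℤ) - 2) ∈ M.prin := by
  obtain ⟨O⟩ := G.exists_unicyclicOrientation hG
  obtain ⟨c, hper, hreach⟩ := O.exists_root
  set n := Function.minimalPeriod O.next c with hn
  have hnc : O.next^[n] c = c := Function.isPeriodicPt_minimalPeriod O.next c
  have hfib : ∀ s : G.E → G.V,
      ∑ x : G.V, Finsupp.single (M.vert x) (Fintype.card {e // s e = x} : ℤ) =
        ∑ e : G.E, Finsupp.single (M.vert (s e)) (1 : ℤ) := by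
    intro s
    rw [← Finset.sum_fiberwise (g := s)]
    refine Finset.sum_congr rfl fun x _ => ?_
    rw [Finset.sum_congr rfl (g := fun _ => Finsupp.single (M.vert x) (1 : ℤ))
      (fun e he => by rw [(Finset.mem_filter.1 he).2])]
    rw [Finset.sum_const, Fintype.card_subtype]
    simp
  have hK : ∑ x : G.V, Finsupp.single (M.vert x) ((G.valence x : ℤ) - 2) =
      ∑ x : G.V, (Finsupp.single (M.vert (O.next x)) (1 : ℤ) - Finsupp.single (M.vert x) 1) := by
    have h1 : ∑ x : G.V, Finsupp.single (M.vert x) ((G.valence x : ℤ) - 2) =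
        ∑ e : G.E, Finsupp.single (M.vert (G.src e)) (1 : ℤ) +
        ∑ e : G.E, Finsupp.single (M.vert (G.tgt e)) (1 : ℤ) -
        ∑ x : G.V, Finsupp.single (M.vert x) (2 : ℤ) := by
      rw [← hfib, ← hfib, ← Finset.sum_add_distrib, ← Finset.sum_sub_distrib]
      refine Finset.sum_congr rfl fun x _ => ?_
      rw [← Finsupp.single_add, ← Finsupp.single_sub, Multigraph.valence]
      push_cast
      rfl
    rw [h1, ← Finset.sum_add_distrib, ← O.edge.sum_comp, ← Finset.sum_sub_distrib]
    refine Finset.sum_congr rfl fun x _ => ?_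
    have h2 : Finsupp.single (M.vert x) (2 : ℤ) =
        Finsupp.single (M.vert x) 1 + Finsupp.single (M.vert x) 1 := by
      rw [← Finsupp.single_add]; rfl
    rcases O.ends x with h | h
    · rw [h.1, h.2, h2]; abel
    · rw [h.1, h.2, h2]; abel
  have := M.boundary_mem_prin_of_sum_drop O hper hreach
    (w := M.path O c n - ∑ x : G.V, M.segment O x 0)
    (sub_mem (M.path_mem O _ _) (sum_mem fun x _ => M.segment_zero_mem O x)) (by
      rw [← holonomy_apply, map_sub, sub_eq_zero]
      trans ∑ i ∈ Finset.range n, M.len (O.edge (O.next^[i] c))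
      · rw [path, map_sum]
        exact Finset.sum_congr rfl fun i _ => by rw [M.holonomy_segment O hper, sub_zero]
      · rw [holonomy_apply]
        refine Finset.sum_congr rfl fun i _ => ?_
        rw [map_sum]
        simp [drop_segment])
  rw [map_sub, boundary_path, hnc, sub_self, zero_sub, map_sum, ← Finset.sum_neg_distrib] at this
  rw [hK]
  convert this using 2 with x
  rw [boundary_segment, pos_zero, neg_sub]

end EdgeModel

/-! ### Principal divisors of finite graphs -/

namespace FiniteGraph

variable (G : FiniteGraph.{u})

theorem ord_eq_sum (f : G.V → ℤ) (x : G.V) : G.ord f x =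
    ∑ e : G.E, ((if G.src e = x then 1 else 0) - (if G.tgt e = x then 1 else 0)) *
      (f (G.tgt e) - f (G.src e)) := by
  refine Finset.sum_congr rfl fun e _ => ?_
  split_ifs with h1 h2 h2
  · exact absurd (h1.trans h2.symm) (G.loopless e)
  · rw [h1]; ring
  · rw [h2]; ring
  · ring

/-- The group of principal divisors. -/
def principal : AddSubgroup (G.V →₀ ℤ) where
  carrier := {D | G.IsPrincipal D}
  zero_mem' := ⟨0, fun x => by simp [ord_eq_sum]⟩
  add_mem' := by
    rintro D D' ⟨f, hf⟩ ⟨f', hf'⟩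
    refine ⟨f + f', fun x => ?_⟩
    rw [Finsupp.add_apply, hf, hf', ord_eq_sum, ord_eq_sum, ord_eq_sum, ← Finset.sum_add_distrib]
    refine Finset.sum_congr rfl fun e _ => ?_
    simp only [Pi.add_apply]
    ring
  neg_mem' := by
    rintro D ⟨f, hf⟩
    refine ⟨-f, fun x => ?_⟩
    rw [Finsupp.neg_apply, hf, ord_eq_sum, ord_eq_sum, ← Finset.sum_neg_distrib]
    refine Finset.sum_congr rfl fun e _ => ?_
    simp only [Pi.neg_apply]
    ring

theorem degree_eq_zero_of_isPrincipal {D : G.V →₀ ℤ} (hD : G.IsPrincipal D) :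
    (D.sum fun _ n => n) = 0 := by
  obtain ⟨f, hf⟩ := hD
  rw [Finsupp.sum_fintype _ _ (fun _ => rfl)]
  simp only [hf, ord_eq_sum]
  rw [Finset.sum_comm]
  refine Finset.sum_eq_zero fun e _ => ?_
  rw [← Finset.sum_mul]
  simp

/-- A finite graph as an edge model with unit edge lengths. -/
def edgeModel : EdgeModel G.toMultigraph G.V where
  len _ := 1
  len_pos _ := one_pos
  Λ := (Int.castAddHom ℝ).range
  len_mem _ := ⟨1, by simp⟩
  vert := id
  ep e t := if 0 < t then G.tgt e else G.src e
  ep_zero e := by simp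
  ep_len e := by simp
  exists_eq z := Or.inl ⟨z, rfl⟩
  prin := G.principal
  mem_prin := by
    intro h hΛ w hw hh
    choose g hg using hΛ
    simp only [Int.coe_castAddHom] at hg
    refine ⟨g, fun x => ?_⟩
    rw [ord_eq_sum]
    rw [← Int.cast_inj (α := ℝ), Finsupp.sum_apply]
    simp only [Finsupp.sum, Finsupp.smul_apply, Finsupp.sub_apply, smul_eq_mul]
    push_cast
    simp only [hg, hh, Finsupp.sum, Finset.mul_sum]
    rw [Finset.sum_comm]
    refine Finset.sum_congr rfl fun q hq => ?_
    obtain ⟨⟨n, hn⟩, h0, h1⟩ := hw q hq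
    rw [Finset.sum_eq_single q.1 (fun e _ he => by simp [he]) (by simp)]
    simp only [Int.coe_castAddHom] at hn
    rw [← hn] at h0 h1 ⊢
    have h0' : 0 ≤ n := by exact_mod_cast h0
    have h1' : n ≤ 1 := by exact_mod_cast h1
    -- With integral positions and unit lengths, a terminal segment is either the whole edge or
    -- empty.
    have : n = 0 ∨ n = 1 := by omega
    rcases this with rfl | rfl
    · simp [Finsupp.single_apply]
      ring
    · simp

end FiniteGraph

/-! ### Piecewise linear functions on an interval -/

/-- Piecewise linear functions with integer slopes on `[0, l]` and breakpoints in `S`. -/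
def IsPiecewiseLinear (g : ℝ → ℝ) (l : ℝ) (S : Finset ℝ) : Prop :=
  ∀ x y : ℝ, 0 ≤ x → x < y → y ≤ l → (∀ s ∈ S, s ∉ Set.Ioo x y) →
    ∃ m : ℤ, ∀ t ∈ Set.Icc x y, g t = g x + m * (t - x)

theorem exists_right_gap (S : Finset ℝ) {z l : ℝ} (h : z < l) :
    ∃ y, z < y ∧ y ≤ l ∧ ∀ s ∈ S, s ∉ Set.Ioo z y := by
  have hne : (insert l (S.filter fun s => z < s ∧ s < l)).Nonempty := ⟨l, by simp⟩
  refine ⟨Finset.min' _ hne, ?_, Finset.min'_le _ l (by simp), fun s hs hs' => ?_⟩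
  · have := Finset.min'_mem _ hne
    simp only [Finset.mem_insert, Finset.mem_filter] at this
    rcases this with h' | h'
    · rw [h']; exact h
    · exact h'.2.1
  · have hl : s < l := hs'.2.trans_le (Finset.min'_le _ l (by simp))
    have := Finset.min'_le (insert l (S.filter fun s => z < s ∧ s < l)) s
      (by simp [hs, hs'.1, hl])
    exact absurd hs'.2 (not_lt.2 this)

theorem exists_left_gap (S : Finset ℝ) {z l : ℝ} (h : l < z) :
    ∃ y, y < z ∧ l ≤ y ∧ ∀ s ∈ S, s ∉ Set.Ioo y z := by
  obtain ⟨y, h1, h2, h3⟩ := exists_right_gap (S.image Neg.neg) (neg_lt_neg h)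
  refine ⟨-y, by linarith, by linarith, fun s hs hs' => ?_⟩
  exact h3 (-s) (Finset.mem_image_of_mem _ hs) ⟨by linarith [hs'.2], by linarith [hs'.1]⟩

theorem hasDerivWithinAt_Ioi_of_affine {g : ℝ → ℝ} {x y m : ℝ} (hxy : x < y)
    (h : ∀ t ∈ Set.Icc x y, g t = g x + m * (t - x)) : HasDerivWithinAt g m (Set.Ioi x) x := by
  have h0 : HasDerivAt (fun t => g x + m * (t - x)) m x := by
    simpa using (((hasDerivAt_id x).sub_const x).const_mul m).const_add (g x)
  refine h0.hasDerivWithinAt.congr_of_eventuallyEq ?_ (by simp)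
  filter_upwards [Ioo_mem_nhdsGT hxy] with t ht
  exact h t ⟨ht.1.le, ht.2.le⟩

theorem hasDerivWithinAt_Iio_of_affine {g : ℝ → ℝ} {x y m : ℝ} (hxy : x < y)
    (h : ∀ t ∈ Set.Icc x y, g t = g x + m * (t - x)) : HasDerivWithinAt g m (Set.Iio y) y := by
  have h0 : HasDerivAt (fun t => g x + m * (t - x)) m y := by
    simpa using (((hasDerivAt_id y).sub_const x).const_mul m).const_add (g x)
  refine h0.hasDerivWithinAt.congr_of_eventuallyEq ?_ (h y ⟨hxy.le, le_rfl⟩)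
  filter_upwards [Ioo_mem_nhdsLT hxy] with t ht
  exact h t ⟨ht.1.le, ht.2.le⟩

namespace IsPiecewiseLinear

variable {g g' : ℝ → ℝ} {l : ℝ} {S S' : Finset ℝ}

theorem add (h : IsPiecewiseLinear g l S) (h' : IsPiecewiseLinear g' l S') :
    IsPiecewiseLinear (fun t => g t + g' t) l (S ∪ S') := by
  intro x y h0 hxy hl hS
  obtain ⟨m, hm⟩ := h x y h0 hxy hl fun s hs => hS s (Finset.mem_union_left _ hs)
  obtain ⟨m', hm'⟩ := h' x y h0 hxy hl fun s hs => hS s (Finset.mem_union_right _ hs)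
  refine ⟨m + m', fun t ht => ?_⟩
  simp only [hm t ht, hm' t ht]
  push_cast
  ring

theorem neg (h : IsPiecewiseLinear g l S) : IsPiecewiseLinear (fun t => - g t) l S := by
  intro x y h0 hxy hl hS
  obtain ⟨m, hm⟩ := h x y h0 hxy hl hS
  refine ⟨-m, fun t ht => ?_⟩
  simp only [hm t ht]
  push_cast
  ring

theorem differentiableWithinAt_Ioi (h : IsPiecewiseLinear g l S) {t : ℝ} (h0 : 0 ≤ t)
    (h1 : t < l) : DifferentiableWithinAt ℝ g (Set.Ioi t) t := by
  obtain ⟨y, hy, hyl, hS⟩ := exists_right_gap S h1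
  obtain ⟨m, hm⟩ := h t y h0 hy hyl hS
  exact (hasDerivWithinAt_Ioi_of_affine hy hm).differentiableWithinAt

theorem differentiableWithinAt_Iio (h : IsPiecewiseLinear g l S) {t : ℝ} (h0 : 0 < t)
    (h1 : t ≤ l) : DifferentiableWithinAt ℝ g (Set.Iio t) t := by
  obtain ⟨x, hx, hx0, hS⟩ := exists_left_gap S h0
  obtain ⟨m, hm⟩ := h x t hx0 hx h1 hS
  exact (hasDerivWithinAt_Iio_of_affine hx hm).differentiableWithinAt

theorem derivWithin_eq (h : IsPiecewiseLinear g l S) {x y : ℝ} (h0 : 0 ≤ x) (hxy : x < y)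
    (hl : y ≤ l) (hS : ∀ s ∈ S, s ∉ Set.Ioo x y) :
    derivWithin g (Set.Iio y) y = derivWithin g (Set.Ioi x) x := by
  obtain ⟨m, hm⟩ := h x y h0 hxy hl hS
  rw [(hasDerivWithinAt_Ioi_of_affine hxy hm).derivWithin (uniqueDiffWithinAt_Ioi x),
    (hasDerivWithinAt_Iio_of_affine hxy hm).derivWithin (uniqueDiffWithinAt_Iio y)]

theorem derivWithin_eq_of_notMem (h : IsPiecewiseLinear g l S) {t : ℝ} (h0 : 0 < t)
    (h1 : t < l) (ht : t ∉ S) :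
    derivWithin g (Set.Ioi t) t = derivWithin g (Set.Iio t) t := by
  obtain ⟨x, hx, hx0, hSx⟩ := exists_left_gap S h0
  obtain ⟨y, hy, hyl, hSy⟩ := exists_right_gap S h1
  obtain ⟨m, hm⟩ := h x y hx0 (hx.trans hy) hyl fun s hs hs' => by
    rcases lt_trichotomy s t with hlt | rfl | hlt
    · exact hSx s hs ⟨hs'.1, hlt⟩
    · exact ht hs
    · exact hSy s hs ⟨hlt, hs'.2⟩
  have hl : ∀ s ∈ Set.Icc x t, g s = g x + m * (s - x) := fun s hs => hm s ⟨hs.1, hs.2.trans hy.le⟩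
  have hr : ∀ s ∈ Set.Icc t y, g s = g t + m * (s - t) := fun s hs => by
    rw [hm s ⟨hx.le.trans hs.1, hs.2⟩, hm t ⟨hx.le, hy.le⟩]
    ring
  rw [(hasDerivWithinAt_Ioi_of_affine hy hr).derivWithin (uniqueDiffWithinAt_Ioi t),
    (hasDerivWithinAt_Iio_of_affine hx hl).derivWithin (uniqueDiffWithinAt_Iio t)]

/-- The slope at `y` is the initial slope plus the changes of slope before `y`. -/
theorem derivWithin_Iio_eq_sum (h : IsPiecewiseLinear g l S) : ∀ (n : ℕ) (y : ℝ), 0 < y → y ≤ l →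
    (S.filter fun s => 0 < s ∧ s < y).card = n →
    derivWithin g (Set.Iio y) y = derivWithin g (Set.Ioi 0) 0 +
      ∑ t ∈ S.filter (fun s => 0 < s ∧ s < y),
        (derivWithin g (Set.Ioi t) t - derivWithin g (Set.Iio t) t) := by
  intro n
  induction n with
  | zero =>
    intro y h0 hl hn
    rw [Finset.card_eq_zero] at hn
    rw [hn, Finset.sum_empty, add_zero]
    refine h.derivWithin_eq le_rfl h0 hl fun s hs hs' => ?_
    have : s ∈ S.filter fun s => 0 < s ∧ s < y := Finset.mem_filter.2 ⟨hs, hs'⟩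
    simp [hn] at this
  | succ n ih =>
    intro y h0 hl hn
    have hne : (S.filter fun s => 0 < s ∧ s < y).Nonempty := by
      rw [← Finset.card_pos]; omega
    -- The slope is constant between the last breakpoint `z` and `y`, so the induction continues
    -- with `z` in place of `y`.
    set z := (S.filter fun s => 0 < s ∧ s < y).max' hne with hz
    have hzm := Finset.max'_mem _ hne
    rw [← hz, Finset.mem_filter] at hzm
    obtain ⟨hzS, hz0, hzy⟩ := hzm
    have hins : (S.filter fun s => 0 < s ∧ s < y) =
        insert z (S.filter fun s => 0 < s ∧ s < z) := by
      ext s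
      simp only [Finset.mem_filter, Finset.mem_insert]
      constructor
      · rintro ⟨hs, h1, h2⟩
        have hle : s ≤ z := Finset.le_max' _ s (Finset.mem_filter.2 ⟨hs, h1, h2⟩)
        rcases hle.eq_or_lt with h | h
        · exact Or.inl h
        · exact Or.inr ⟨hs, h1, h⟩
      · rintro (rfl | ⟨hs, h1, h2⟩)
        · exact ⟨hzS, hz0, hzy⟩
        · exact ⟨hs, h1, h2.trans hzy⟩
    have hnot : z ∉ S.filter fun s => 0 < s ∧ s < z := by simp
    have hcard := hn
    rw [hins, Finset.card_insert_of_notMem hnot] at hcard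
    rw [hins, Finset.sum_insert hnot]
    have := ih z hz0 (hzy.le.trans hl) (by omega)
    rw [h.derivWithin_eq hz0.le hzy hl fun s hs hs' => absurd hs'.1 (not_lt.2
      (Finset.le_max' _ s (Finset.mem_filter.2 ⟨hs, hz0.trans hs'.1, hs'.2⟩)))]
    linarith

end IsPiecewiseLinear

/-! ### Principal divisors of metric graphs -/

namespace MetricGraph

variable (Γ : MetricGraph.{u})

theorem edgePoint_of_mem {e : Γ.E} {t : ℝ} (h0 : 0 < t) (h1 : t < Γ.len e) :
    Γ.edgePoint e t = Point.inner e t h0 h1 := by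
  simp [edgePoint, h0, h1]

theorem edgePoint_of_nonpos {e : Γ.E} {t : ℝ} (h0 : t ≤ 0) :
    Γ.edgePoint e t = Point.vertex (Γ.src e) := by
  simp [edgePoint, h0]

theorem edgePoint_of_len_le {e : Γ.E} {t : ℝ} (h : Γ.len e ≤ t) :
    Γ.edgePoint e t = Point.vertex (Γ.tgt e) := by
  simp [edgePoint, (Γ.len_pos e).trans_le h, h]

variable {Γ}

theorem IsRational.slopeUp_add {f f' : Γ.Point → ℝ} (hf : Γ.IsRational f) (hf' : Γ.IsRational f')
    (e : Γ.E) {t : ℝ} (h0 : 0 ≤ t) (h1 : t < Γ.len e) :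
    Γ.slopeUp (f + f') e t = Γ.slopeUp f e t + Γ.slopeUp f' e t := by
  obtain ⟨S, hS⟩ := hf e
  obtain ⟨S', hS'⟩ := hf' e
  exact derivWithin_fun_add (IsPiecewiseLinear.differentiableWithinAt_Ioi hS h0 h1)
    (IsPiecewiseLinear.differentiableWithinAt_Ioi hS' h0 h1)

theorem IsRational.slopeDown_add {f f' : Γ.Point → ℝ} (hf : Γ.IsRational f)
    (hf' : Γ.IsRational f') (e : Γ.E) {t : ℝ} (h0 : 0 < t) (h1 : t ≤ Γ.len e) :
    Γ.slopeDown (f + f') e t = Γ.slopeDown f e t + Γ.slopeDown f' e t := by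
  obtain ⟨S, hS⟩ := hf e
  obtain ⟨S', hS'⟩ := hf' e
  have := derivWithin_fun_add (IsPiecewiseLinear.differentiableWithinAt_Iio hS h0 h1)
    (IsPiecewiseLinear.differentiableWithinAt_Iio hS' h0 h1)
  simp only [slopeDown, Pi.add_apply]
  rw [this]
  ring

theorem IsRational.ord_add {f f' : Γ.Point → ℝ} (hf : Γ.IsRational f) (hf' : Γ.IsRational f')
    (p : Γ.Point) : Γ.ord (f + f') p = Γ.ord f p + Γ.ord f' p := by
  cases p with
  | vertex x =>
    simp only [ord]
    rw [← Finset.sum_add_distrib]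
    refine Finset.sum_congr rfl fun e _ => ?_
    rw [hf.slopeUp_add hf' e le_rfl (Γ.len_pos e), hf.slopeDown_add hf' e (Γ.len_pos e) le_rfl]
    split_ifs <;> ring
  | inner e t h0 h1 =>
    simp only [ord]
    rw [hf.slopeUp_add hf' e h0.le h1, hf.slopeDown_add hf' e h0 h1.le]
    ring

theorem ord_neg (f : Γ.Point → ℝ) (p : Γ.Point) : Γ.ord (-f) p = - Γ.ord f p := by
  have hu : ∀ e t, Γ.slopeUp (-f) e t = - Γ.slopeUp f e t := fun e t => derivWithin.fun_neg
  have hd : ∀ e t, Γ.slopeDown (-f) e t = - Γ.slopeDown f e t := fun e t =>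
    congrArg Neg.neg derivWithin.fun_neg
  cases p with
  | vertex x =>
    simp only [ord]
    rw [← Finset.sum_neg_distrib]
    refine Finset.sum_congr rfl fun e _ => ?_
    rw [hu, hd]
    split_ifs <;> ring
  | inner e t h0 h1 =>
    simp only [ord]
    rw [hu, hd]
    ring

variable (Γ)

/-- The group of principal divisors. -/
def principal : AddSubgroup (Γ.Point →₀ ℤ) where
  carrier := {D | Γ.IsPrincipal D}
  zero_mem' := by
    refine ⟨fun _ => 0, fun e => ⟨∅, fun x y _ _ _ _ => ?_⟩, fun p => ?_⟩
    · exact ⟨0, fun t _ => by simp⟩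
    · cases p <;> simp [ord, slopeUp, slopeDown]
  add_mem' := by
    rintro D D' ⟨f, hf, h⟩ ⟨f', hf', h'⟩
    refine ⟨f + f', fun e => ?_, fun p => ?_⟩
    · obtain ⟨S, hS⟩ := hf e
      obtain ⟨S', hS'⟩ := hf' e
      exact ⟨S ∪ S', IsPiecewiseLinear.add hS hS'⟩
    · rw [hf.ord_add hf', ← h, ← h']
      simp
  neg_mem' := by
    rintro D ⟨f, hf, h⟩
    refine ⟨-f, fun e => ?_, fun p => ?_⟩
    · obtain ⟨S, hS⟩ := hf e
      exact ⟨S, IsPiecewiseLinear.neg hS⟩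
    · rw [ord_neg, ← h]
      simp

/-- The support consists of vertices and interior breakpoints. Grouped by edge, the outgoing slopes
at both ends and the slope changes in between telescope to zero. -/
theorem degree_eq_zero_of_isPrincipal {D : Γ.Point →₀ ℤ} (hD : Γ.IsPrincipal D) :
    (D.sum fun _ n => n) = 0 := by
  obtain ⟨f, hf, hord⟩ := hD
  choose S hS using hf
  let B : Γ.E → Finset ℝ := fun e => (S e).filter fun s => 0 < s ∧ s < Γ.len e
  have hB : ∀ e, ∀ t ∈ B e, 0 < t ∧ t < Γ.len e := fun e t ht => (Finset.mem_filter.1 ht).2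
  let T₁ : Finset Γ.Point := Finset.univ.image Point.vertex
  let T₂ : Finset Γ.Point := Finset.univ.biUnion fun e => (B e).image (Γ.edgePoint e)
  have hdisj : Disjoint T₁ T₂ := by
    rw [Finset.disjoint_left]
    intro p h1 h2
    simp only [T₁, T₂, Finset.mem_image, Finset.mem_univ, true_and, Finset.mem_biUnion] at h1 h2
    obtain ⟨x, rfl⟩ := h1
    obtain ⟨e, t, ht, h⟩ := h2
    rw [edgePoint_of_mem Γ (hB e t ht).1 (hB e t ht).2] at h
    cases h
  have hsupp : D.support ⊆ T₁ ∪ T₂ := by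
    intro p hp
    rw [Finset.mem_union]
    cases p with
    | vertex x => left; simp [T₁]
    | inner e t h0 h1 =>
      right
      simp only [T₂, Finset.mem_biUnion, Finset.mem_univ, true_and, Finset.mem_image]
      refine ⟨e, t, ?_, edgePoint_of_mem Γ h0 h1⟩
      refine Finset.mem_filter.2 ⟨?_, h0, h1⟩
      by_contra hn
      have h := hord (Point.inner e t h0 h1)
      have := IsPiecewiseLinear.derivWithin_eq_of_notMem (hS e) h0 h1 hn
      simp only [ord, slopeUp, slopeDown, this] at h
      rw [add_neg_cancel] at h
      exact (Finsupp.mem_support_iff.1 hp) (by exact_mod_cast h)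
  rw [Finsupp.sum_of_support_subset _ hsupp _ (fun _ _ => rfl), Finset.sum_union hdisj,
    ← Int.cast_inj (α := ℝ)]
  push_cast
  simp only [hord]
  have hT₁ : ∑ p ∈ T₁, Γ.ord f p = ∑ e : Γ.E, (Γ.slopeUp f e 0 + Γ.slopeDown f e (Γ.len e)) := by
    rw [Finset.sum_image (fun x _ y _ h => by cases h; rfl)]
    simp only [ord]
    rw [Finset.sum_comm]
    refine Finset.sum_congr rfl fun e _ => ?_
    rw [Finset.sum_add_distrib]
    simp
  have hT₂ : ∑ p ∈ T₂, Γ.ord f p =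
      ∑ e : Γ.E, ∑ t ∈ B e, (Γ.slopeUp f e t + Γ.slopeDown f e t) := by
    rw [Finset.sum_biUnion]
    · refine Finset.sum_congr rfl fun e _ => ?_
      rw [Finset.sum_image]
      · refine Finset.sum_congr rfl fun t ht => ?_
        rw [edgePoint_of_mem Γ (hB e t ht).1 (hB e t ht).2]
        rfl
      · intro s hs t ht h
        rw [edgePoint_of_mem Γ (hB e t ht).1 (hB e t ht).2,
          edgePoint_of_mem Γ (hB e s hs).1 (hB e s hs).2] at h
        cases h
        rfl
    · intro e _ e' _ hne
      rw [Function.onFun, Finset.disjoint_left]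
      intro p h1 h2
      simp only [Finset.mem_image] at h1 h2
      obtain ⟨s, hs, rfl⟩ := h1
      obtain ⟨t, ht, h⟩ := h2
      rw [edgePoint_of_mem Γ (hB _ t ht).1 (hB _ t ht).2,
        edgePoint_of_mem Γ (hB _ s hs).1 (hB _ s hs).2] at h
      cases h
      exact hne rfl
  rw [hT₁, hT₂, ← Finset.sum_add_distrib]
  refine Finset.sum_eq_zero fun e _ => ?_
  have := IsPiecewiseLinear.derivWithin_Iio_eq_sum (hS e) _ (Γ.len e) (Γ.len_pos e) le_rfl rfl
  simp only [slopeUp, slopeDown, ← sub_eq_add_neg]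
  rw [this]
  simp only [B]
  ring

variable {Γ}

/-- The rational function with vertex values `h` and changes of slope `w`. -/
def rationalOf (h : Γ.V → ℝ) (w : (Γ.E × ℝ) →₀ ℤ) : Γ.Point → ℝ
  | Point.vertex x => h x
  | Point.inner e t _ _ =>
      h (Γ.src e) + w.sum fun q n => n * if q.1 = e then max 0 (t - q.2) else 0

/-! ### Orders of functions with prescribed changes of slope. -/

variable {h : Γ.V → ℝ} {w : (Γ.E × ℝ) →₀ ℤ}

/-- The interior formula also holds at both ends: at `0` no hinge has opened, and at the target `hh`
says exactly that the values agree. -/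
theorem rationalOf_edgePoint
    (hw : ∀ q ∈ w.support, 0 ≤ q.2 ∧ q.2 ≤ Γ.len q.1)
    (hh : ∀ e, h (Γ.tgt e) - h (Γ.src e) =
      w.sum fun q n => n • (Pi.single q.1 (Γ.len q.1 - q.2) : Γ.E → ℝ) e)
    (e : Γ.E) {t : ℝ} (h0 : 0 ≤ t) (h1 : t ≤ Γ.len e) :
    rationalOf h w (Γ.edgePoint e t) =
      h (Γ.src e) + w.sum fun q n => n * if q.1 = e then max 0 (t - q.2) else 0 := by
  rcases h0.eq_or_lt with rfl | h0
  · rw [edgePoint_of_nonpos Γ le_rfl, rationalOf, Finsupp.sum, Finset.sum_eq_zero, add_zero]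
    intro q hq
    rw [max_eq_left (by linarith [(hw q hq).1]), ite_self, mul_zero]
  · rcases h1.eq_or_lt with rfl | h1
    · rw [edgePoint_of_len_le Γ le_rfl, rationalOf, ← sub_eq_iff_eq_add', hh]
      refine Finset.sum_congr rfl fun q hq => ?_
      simp only [Pi.single_apply, zsmul_eq_mul]
      by_cases he : q.1 = e
      · subst he
        rw [if_pos rfl, if_pos rfl, max_eq_right (by linarith [(hw q hq).2])]
      · rw [if_neg he, if_neg (Ne.symm he)]
    · rw [edgePoint_of_mem Γ h0 h1, rationalOf]

theorem rationalOf_affine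
    (hw : ∀ q ∈ w.support, 0 ≤ q.2 ∧ q.2 ≤ Γ.len q.1)
    (hh : ∀ e, h (Γ.tgt e) - h (Γ.src e) =
      w.sum fun q n => n • (Pi.single q.1 (Γ.len q.1 - q.2) : Γ.E → ℝ) e)
    (e : Γ.E) {x y : ℝ} (h0 : 0 ≤ x) (hxy : x < y) (hl : y ≤ Γ.len e)
    (hS : ∀ s ∈ w.support.image Prod.snd, s ∉ Set.Ioo x y) : ∀ t ∈ Set.Icc x y,
    rationalOf h w (Γ.edgePoint e t) = rationalOf h w (Γ.edgePoint e x) +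
      ((w.sum fun q n => if q.1 = e ∧ q.2 ≤ x then n else 0 : ℤ) : ℝ) * (t - x) := by
  intro t ht
  rw [rationalOf_edgePoint hw hh e (h0.trans ht.1) (ht.2.trans hl),
    rationalOf_edgePoint hw hh e h0 (hxy.le.trans hl), add_assoc, add_right_inj]
  simp only [Finsupp.sum]
  push_cast
  rw [Finset.sum_mul, ← Finset.sum_add_distrib]
  refine Finset.sum_congr rfl fun q hq => ?_
  have hq' : q.2 ≤ x ∨ y ≤ q.2 := by
    have := hS q.2 (Finset.mem_image_of_mem _ hq)
    rw [Set.mem_Ioo, not_and_or, not_lt, not_lt] at this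
    exact this
  by_cases he : q.1 = e
  · rcases hq' with hq' | hq'
    · rw [if_pos he, if_pos he, if_pos ⟨he, hq'⟩, max_eq_right (by linarith [ht.1]),
        max_eq_right (by linarith)]
      ring
    · rw [if_pos he, if_pos he, if_neg (fun hc => by linarith [hc.2]),
        max_eq_left (by linarith [ht.2]), max_eq_left (by linarith)]
      ring
  · simp [he]

theorem isRational_rationalOf
    (hw : ∀ q ∈ w.support, 0 ≤ q.2 ∧ q.2 ≤ Γ.len q.1)
    (hh : ∀ e, h (Γ.tgt e) - h (Γ.src e) =
      w.sum fun q n => n • (Pi.single q.1 (Γ.len q.1 - q.2) : Γ.E → ℝ) e) :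
    Γ.IsRational (rationalOf h w) := fun e =>
  ⟨w.support.image Prod.snd, fun _ _ h0 hxy hl hS =>
    ⟨_, rationalOf_affine hw hh e h0 hxy hl hS⟩⟩

theorem slopeUp_rationalOf
    (hw : ∀ q ∈ w.support, 0 ≤ q.2 ∧ q.2 ≤ Γ.len q.1)
    (hh : ∀ e, h (Γ.tgt e) - h (Γ.src e) =
      w.sum fun q n => n • (Pi.single q.1 (Γ.len q.1 - q.2) : Γ.E → ℝ) e)
    (e : Γ.E) {t : ℝ} (h0 : 0 ≤ t) (h1 : t < Γ.len e) :
    Γ.slopeUp (rationalOf h w) e t = w.sum fun q n => (n : ℝ) * if q.1 = e ∧ q.2 ≤ t then 1 else 0 := by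
  obtain ⟨y, hy, hyl, hS⟩ := exists_right_gap (w.support.image Prod.snd) h1
  rw [slopeUp, (hasDerivWithinAt_Ioi_of_affine hy
    (rationalOf_affine hw hh e h0 hy hyl hS)).derivWithin (uniqueDiffWithinAt_Ioi t)]
  simp [Finsupp.sum]

theorem slopeDown_rationalOf
    (hw : ∀ q ∈ w.support, 0 ≤ q.2 ∧ q.2 ≤ Γ.len q.1)
    (hh : ∀ e, h (Γ.tgt e) - h (Γ.src e) =
      w.sum fun q n => n • (Pi.single q.1 (Γ.len q.1 - q.2) : Γ.E → ℝ) e)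
    (e : Γ.E) {t : ℝ} (h0 : 0 < t) (h1 : t ≤ Γ.len e) :
    Γ.slopeDown (rationalOf h w) e t =
      - w.sum fun q n => (n : ℝ) * if q.1 = e ∧ q.2 < t then 1 else 0 := by
  obtain ⟨x, hx, hx0, hS⟩ := exists_left_gap (w.support.image Prod.snd) h0
  rw [slopeDown, (hasDerivWithinAt_Iio_of_affine hx
    (rationalOf_affine hw hh e hx0 hx h1 hS)).derivWithin (uniqueDiffWithinAt_Iio t)]
  simp only [Finsupp.sum]
  push_cast
  congr 1
  refine Finset.sum_congr rfl fun q hq => ?_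
  have hiff : q.2 ≤ x ↔ q.2 < t := by
    refine ⟨fun hc => hc.trans_lt hx, fun hc => ?_⟩
    by_contra hn
    exact hS q.2 (Finset.mem_image_of_mem _ hq) ⟨not_le.1 hn, hc⟩
  simp [hiff]

/-- The right slope counts hinges at positions `≤ t` and the left slope those at positions `< t`, so
an interior point sees the coefficient of its own hinge. At a vertex, outgoing edges contribute
hinges at `0` and incoming edges minus those before the end; a hinge at the very end has zero
boundary. -/
theorem ord_rationalOf
    (hw : ∀ q ∈ w.support, 0 ≤ q.2 ∧ q.2 ≤ Γ.len q.1)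
    (hh : ∀ e, h (Γ.tgt e) - h (Γ.src e) =
      w.sum fun q n => n • (Pi.single q.1 (Γ.len q.1 - q.2) : Γ.E → ℝ) e)
    (p : Γ.Point) : Γ.ord (rationalOf h w) p =
    ((w.sum fun q n => n • (Finsupp.single (Γ.edgePoint q.1 q.2) (1 : ℤ) -
      Finsupp.single (Point.vertex (Γ.tgt q.1)) 1) : Γ.Point →₀ ℤ) p : ℤ) := by
  simp only [Finsupp.sum, Finsupp.finsetSum_apply, Finsupp.smul_apply, Finsupp.sub_apply,
    smul_eq_mul, Finsupp.single_apply]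
  push_cast
  cases p with
  | inner e t h0 h1 =>
    simp only [ord]
    rw [slopeUp_rationalOf hw hh e h0.le h1, slopeDown_rationalOf hw hh e h0 h1.le,
      ← sub_eq_add_neg, Finsupp.sum, Finsupp.sum, ← Finset.sum_sub_distrib]
    refine Finset.sum_congr rfl fun q hq => ?_
    rw [← mul_sub]
    congr 1
    have hv : ¬ (Point.vertex (Γ.tgt q.1) : Γ.Point) = Point.inner e t h0 h1 := fun h => by cases h
    have hiff : Γ.edgePoint q.1 q.2 = Point.inner e t h0 h1 ↔ q.1 = e ∧ q.2 = t := by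
      constructor
      · intro hq'
        unfold edgePoint at hq'
        split_ifs at hq'
        cases hq'
        exact ⟨rfl, rfl⟩
      · rintro ⟨rfl, rfl⟩
        exact edgePoint_of_mem Γ h0 h1
    simp only [hiff, hv, if_false, sub_zero]
    by_cases he : q.1 = e
    · simp only [he, true_and]
      rcases lt_trichotomy q.2 t with hlt | heq | hlt
      · simp [hlt, hlt.le, hlt.ne]
      · simp [heq]
      · simp [hlt.not_ge, hlt.not_gt, hlt.ne']
    · simp [he]
  | vertex x =>
    simp only [ord]
    have hstep : ∀ e, ((if Γ.src e = x then Γ.slopeUp (rationalOf h w) e 0 else 0) +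
        (if Γ.tgt e = x then Γ.slopeDown (rationalOf h w) e (Γ.len e) else 0)) =
        ∑ q ∈ w.support, (w q : ℝ) * ((if q.1 = e ∧ Γ.src e = x ∧ q.2 ≤ 0 then 1 else 0) -
          if q.1 = e ∧ Γ.tgt e = x ∧ q.2 < Γ.len e then 1 else 0) := by
      intro e
      rw [slopeUp_rationalOf hw hh e le_rfl (Γ.len_pos e),
        slopeDown_rationalOf hw hh e (Γ.len_pos e) le_rfl]
      simp only [mul_sub, Finset.sum_sub_distrib, Finsupp.sum]
      split_ifs with h1 h2 h2 <;> simp [h1, h2, sub_eq_add_neg]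
    simp only [hstep]
    rw [Finset.sum_comm]
    refine Finset.sum_congr rfl fun q hq => ?_
    rw [← Finset.mul_sum]
    congr 1
    rw [Finset.sum_eq_single q.1 (fun e _ he => by simp [Ne.symm he]) (by simp)]
    have hpos := Γ.len_pos q.1
    by_cases h0 : q.2 ≤ 0
    · simp [edgePoint_of_nonpos Γ h0, h0, h0.trans_lt hpos]
    · rcases (hw q hq).2.lt_or_eq with h1 | h1
      · simp [edgePoint_of_mem Γ (not_le.1 h0) h1, h0, h1]
      · rw [edgePoint_of_len_le Γ h1.ge]
        simp [h0, h1.not_lt]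

variable (Γ)

/-- A metric graph as an edge model. -/
def edgeModel : EdgeModel Γ.toMultigraph Γ.Point where
  len := Γ.len
  len_pos := Γ.len_pos
  Λ := ⊤
  len_mem _ := trivial
  vert := Point.vertex
  ep := Γ.edgePoint
  ep_zero _ := edgePoint_of_nonpos Γ le_rfl
  ep_len _ := edgePoint_of_len_le Γ le_rfl
  exists_eq z := by
    cases z with
    | vertex x => exact Or.inl ⟨x, rfl⟩
    | inner e t h0 h1 =>
      exact Or.inr ⟨e, t, trivial, h0.le, h1.le, (edgePoint_of_mem Γ h0 h1).symm⟩
  prin := Γ.principal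
  mem_prin := fun h _ w hw hh => ⟨rationalOf h w,
    isRational_rationalOf (fun q hq => (hw q hq).2) hh,
    fun p => (ord_rationalOf (fun q hq => (hw q hq).2) hh p).symm⟩

end MetricGraph

/-! ### Shifted simple reflections -/

theorem simpleReflection_apply (k : ℕ) (m n : ℤ) : simpleReflection k (m - 1) n =
    if (k : ℤ) ∣ n + 1 - m then n + 1 else if (k : ℤ) ∣ n - m then n - 1 else n := by
  have h1 : n ≡ m - 1 [ZMOD k] ↔ (k : ℤ) ∣ n + 1 - m := by
    rw [Int.modEq_comm, Int.modEq_iff_dvd, sub_sub_eq_add_sub]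
  have h2 : n ≡ m - 1 + 1 [ZMOD k] ↔ (k : ℤ) ∣ n - m := by
    rw [sub_add_cancel, Int.modEq_comm, Int.modEq_iff_dvd]
  show (if _ then _ else if _ then _ else _) = _
  simp only [h1, h2]

theorem not_dvd_succ {k : ℕ} (hk : k ≠ 1) {a : ℤ} (h : (k : ℤ) ∣ a) : ¬ (k : ℤ) ∣ a + 1 := by
  intro h'
  have := (Int.dvd_add_right h).1 h'
  exact hk (by exact_mod_cast Int.eq_one_of_dvd_one (Int.natCast_nonneg k) this)

/-- `s` exchanges `n - 1` and `n` whenever `e n` holds, and fixes all other integers. -/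
structure IsNearIdentity (s : ℤ → ℤ) (e : ℤ → Prop) : Prop where
  down : ∀ n, e n → s n = n - 1
  up : ∀ n, e (n + 1) → s n = n + 1
  fixed : ∀ n, ¬ e n → ¬ e (n + 1) → s n = n

theorem isNearIdentity_simpleReflection {k : ℕ} (hk : k ≠ 1) (m : ℤ) :
    IsNearIdentity (simpleReflection k (m - 1)) fun n => (k : ℤ) ∣ n - m where
  down n hn := by
    have : ¬ (k : ℤ) ∣ n + 1 - m := by
      rw [add_sub_right_comm]; exact not_dvd_succ hk hn
    rw [simpleReflection_apply, if_neg this, if_pos hn]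
  up n hn := by rw [simpleReflection_apply, if_pos hn]
  fixed n h h' := by rw [simpleReflection_apply, if_neg h', if_neg h]

theorem isNearIdentity_id : IsNearIdentity id fun _ => False := by
  constructor <;> simp

/-! ### Counting positions and values of near-identity maps. -/

theorem ncard_Icc_int (a b : ℤ) : ((Set.Icc a b).ncard : ℤ) = max (b + 1 - a) 0 := by
  rw [← Finset.coe_Icc, Set.ncard_coe_finset, Int.card_Icc, Int.toNat_eq_max]

theorem ncard_insert_Icc_erase {a b : ℤ} {S : Set ℤ} (h : S = insert (b + 1) (Set.Icc a (b - 1)))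
    (hab : a ≤ b) : (S.ncard : ℤ) = b + 1 - a ∧ S.Finite := by
  subst h
  constructor
  · rw [Set.ncard_insert_of_notMem (by simp) (Set.finite_Icc _ _), Nat.cast_add, ncard_Icc_int]
    push_cast
    omega
  · exact (Set.finite_Icc _ _).insert _

/-- Numbers of values at most `A` at positions at least `b`. -/
theorem IsNearIdentity.count_ge {s : ℤ → ℤ} {e : ℤ → Prop} (h : IsNearIdentity s e) (A b : ℤ) :
    {n : ℤ | b ≤ n ∧ s n ≤ A}.Finite ∧ ({n : ℤ | b ≤ n ∧ s n ≤ A}.ncard : ℤ) =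
      if A = b - 1 ∧ e b then 1 else max (A + 1 - b) 0 := by
  have cases : ∀ n, (e n ∧ s n = n - 1) ∨ (e (n + 1) ∧ s n = n + 1) ∨
      (¬ e n ∧ ¬ e (n + 1) ∧ s n = n) := by
    intro n
    by_cases h1 : e n
    · exact Or.inl ⟨h1, h.down n h1⟩
    · by_cases h2 : e (n + 1)
      · exact Or.inr (Or.inl ⟨h2, h.up n h2⟩)
      · exact Or.inr (Or.inr ⟨h1, h2, h.fixed n h1 h2⟩)
  by_cases hA : b ≤ A
  · rw [if_neg (by omega), max_eq_left (by omega)]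
    -- An exchange across the threshold trades position `A` for `A + 1`, which leaves the count
    -- unchanged because `A ≥ b`. It can change the count only when `A = b - 1`, where `A` is not an
    -- allowed position.
    by_cases hE : e (A + 1)
    · rw [and_comm]
      refine ncard_insert_Icc_erase ?_ hA
      ext n
      simp only [Set.mem_ofPred_eq, Set.mem_insert_iff, Set.mem_Icc]
      have hd := h.down _ hE
      have hu := h.up _ hE
      constructor
      · rintro ⟨h1, h2⟩
        rcases cases n with hc | hc | hc
        · by_cases n = A
          · subst n; omega
          · omega
        · by_cases n = A
          · subst n; omega
          · omega
        · by_cases n = A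
          · subst n; omega
          · omega
      · rintro (rfl | h1)
        · omega
        · rcases cases n with hc | hc | hc <;> omega
    · have : {n : ℤ | b ≤ n ∧ s n ≤ A} = Set.Icc b A := by
        ext n
        simp only [Set.mem_ofPred_eq, Set.mem_Icc]
        refine and_congr_right fun _ => ?_
        rcases cases n with hc | hc | hc
        · by_cases hn : n = A + 1
          · subst hn; exact absurd hc.1 hE
          · omega
        · by_cases hn : n = A
          · subst hn; exact absurd hc.1 hE
          · omega
        · omega
      rw [this, ncard_Icc_int]
      exact ⟨Set.finite_Icc _ _, by omega⟩
  · by_cases hE : A = b - 1 ∧ e b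
    · rw [if_pos hE]
      have : {n : ℤ | b ≤ n ∧ s n ≤ A} = {b} := by
        ext n
        simp only [Set.mem_ofPred_eq, Set.mem_singleton_iff]
        constructor
        · rintro ⟨h1, h2⟩
          rcases cases n with hc | hc | hc <;> omega
        · rintro rfl
          have := h.down n hE.2
          omega
      rw [this]
      simp
    · rw [if_neg hE, max_eq_right (by omega)]
      have : {n : ℤ | b ≤ n ∧ s n ≤ A} = ∅ := by
        ext n
        simp only [Set.mem_ofPred_eq, Set.mem_empty_iff_false, iff_false, not_and]
        intro h1 h2
        rcases cases n with hc | hc | hc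
        · have hn : n = b := by omega
          subst hn
          exact hE ⟨by omega, hc.1⟩
        · omega
        · omega
      rw [this]
      simp

/-- Reversing the integers. -/
theorem IsNearIdentity.neg {s : ℤ → ℤ} {e : ℤ → Prop} (h : IsNearIdentity s e) :
    IsNearIdentity (fun n => - s (-n)) fun n => e (1 - n) where
  down n hn := by
    have := h.up (-n) (by rwa [neg_add_eq_sub])
    simp only [this]; ring
  up n hn := by
    have := h.down (-n) (by rwa [show 1 - (n + 1) = -n by ring] at hn)
    simp only [this]; ring
  fixed n h1 h2 := by
    have := h.fixed (-n) (by rwa [show 1 - (n + 1) = -n by ring] at h2) (by rwa [neg_add_eq_sub])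
    simp only [this]; ring

/-- Numbers of values greater than `A` at positions less than `b`. -/
theorem IsNearIdentity.count_lt {s : ℤ → ℤ} {e : ℤ → Prop} (h : IsNearIdentity s e) (A b : ℤ) :
    {n : ℤ | n < b ∧ A < s n}.Finite ∧ ({n : ℤ | n < b ∧ A < s n}.ncard : ℤ) =
      if A = b - 1 ∧ e b then 1 else max (b - 1 - A) 0 := by
  -- Under `n ↦ -n`, `n < b` becomes `1 - b ≤ -n` and `A < s n` becomes `-s n ≤ -A - 1`.
  have key := h.neg.count_ge (-A - 1) (1 - b)
  have himg : {n : ℤ | n < b ∧ A < s n} =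
      (Equiv.neg ℤ) '' {n : ℤ | 1 - b ≤ n ∧ - s (-n) ≤ -A - 1} := by
    ext n
    rw [Equiv.image_eq_preimage_symm]
    simp only [Set.mem_ofPred_eq, Equiv.neg_symm, Set.mem_preimage, Equiv.neg_apply, neg_neg]
    omega
  rw [himg]
  refine ⟨key.1.image _, ?_⟩
  rw [Set.ncard_image_of_injective _ (Equiv.injective _), key.2]
  have : (-A - 1 = 1 - b - 1 ∧ e (1 - (1 - b))) ↔ (A = b - 1 ∧ e b) := by
    rw [sub_sub_cancel]
    exact and_congr_left fun _ => by omega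
  simp only [this]
  congr 1
  congr 1
  ring

/-- Raising `b` by one lowers the count exactly when the value at `b` is at most `a`, so the counts
determine every value. -/
theorem perm_eq_of_ncard_eq {τ τ' : Equiv.Perm ℤ}
    (h : ∀ a b : ℤ, {n : ℤ | b ≤ n ∧ τ n ≤ a}.Finite ∧ {n : ℤ | b ≤ n ∧ τ' n ≤ a}.Finite ∧
      {n : ℤ | b ≤ n ∧ τ n ≤ a}.ncard = {n : ℤ | b ≤ n ∧ τ' n ≤ a}.ncard) : τ = τ' := by
  have step : ∀ (σ : Equiv.Perm ℤ) (a b : ℤ), {n : ℤ | b ≤ n ∧ σ n ≤ a}.Finite →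
      {n : ℤ | b ≤ n ∧ σ n ≤ a}.ncard =
        {n : ℤ | b + 1 ≤ n ∧ σ n ≤ a}.ncard + if σ b ≤ a then 1 else 0 := by
    intro σ a b hf
    split_ifs with hb
    · have : {n : ℤ | b ≤ n ∧ σ n ≤ a} = insert b {n : ℤ | b + 1 ≤ n ∧ σ n ≤ a} := by
        ext n
        simp only [Set.mem_ofPred_eq, Set.mem_insert_iff]
        constructor
        · rintro ⟨h1, h2⟩
          rcases h1.eq_or_lt with rfl | h1
          · exact Or.inl rfl
          · exact Or.inr ⟨h1, h2⟩
        · rintro (rfl | h1)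
          · exact ⟨le_rfl, hb⟩
          · exact ⟨by omega, h1.2⟩
      rw [this, Set.ncard_insert_of_notMem (by simp)
        (hf.subset fun n hn => ⟨by have := hn.1; omega, hn.2⟩)]
    · rw [add_zero]
      congr 1
      ext n
      simp only [Set.mem_ofPred_eq]
      constructor
      · rintro ⟨h1, h2⟩
        rcases h1.eq_or_lt with rfl | h1
        · exact absurd h2 hb
        · exact ⟨h1, h2⟩
      · rintro ⟨h1, h2⟩
        exact ⟨by omega, h2⟩
  have key : ∀ a b, τ b ≤ a ↔ τ' b ≤ a := by
    intro a b
    have h1 := step τ a b (h a b).1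
    have h2 := step τ' a b (h a b).2.1
    rw [(h a b).2.2, h2, (h a (b + 1)).2.2] at h1
    split_ifs at h1 <;> omega
  ext b
  exact le_antisymm ((key _ b).2 le_rfl) ((key _ b).1 le_rfl)

/-! ### Inversions -/

/-- No position moves by more than one, so positions at distance at least two cannot be inverted. -/
theorem IsNearIdentity.inversion {τ : Equiv.Perm ℤ} {d : ℤ} {s : ℤ → ℤ} {e : ℤ → Prop}
    (h : IsNearIdentity s e) (hτ : ∀ n, τ n = s n - d) (p : Inversion τ) :
    p.1.2 = p.1.1 + 1 ∧ e p.1.2 := by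
  obtain ⟨⟨i, j⟩, hij, hlt⟩ := p
  simp only [hτ] at hij hlt ⊢
  have cases : ∀ n, (e n ∧ s n = n - 1) ∨ (e (n + 1) ∧ s n = n + 1) ∨ s n = n := by
    intro n
    by_cases h1 : e n
    · exact Or.inl ⟨h1, h.down n h1⟩
    · by_cases h2 : e (n + 1)
      · exact Or.inr (Or.inl ⟨h2, h.up n h2⟩)
      · exact Or.inr (Or.inr (h.fixed n h1 h2))
  by_cases hj : j = i + 1
  · subst hj
    refine ⟨rfl, ?_⟩
    rcases cases (i + 1) with hc | hc | hc
    · exact hc.1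
    · rcases cases i with hc' | hc' | hc'
      · omega
      · exact hc'.1
      · omega
    · rcases cases i with hc' | hc' | hc'
      · omega
      · exact hc'.1
      · omega
  · exfalso
    rcases cases i with hc | hc | hc <;> rcases cases j with hc' | hc' | hc' <;>
      omega

theorem shift_mul_apply (d n : ℤ) (σ : Equiv.Perm ℤ) : (shift d * σ) n = σ n - d := rfl

theorem shift_mem_extAffine (k : ℕ) (d : ℤ) : shift d ∈ extAffine k := by
  have hemp : IsEmpty (Inversion (shift d)) :=
    ⟨fun p => (isNearIdentity_id.inversion (d := d) (fun _ => rfl) p).2⟩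
  simp only [extAffine, Set.mem_ofPred_eq]
  split_ifs
  · infer_instance
  · intro n
    show n + k - d = n - d + k
    ring

theorem invCount_shift (k : ℕ) (d : ℤ) : invCount k (shift d) = 0 := by
  have hemp : IsEmpty (Inversion (shift d)) :=
    ⟨fun p => (isNearIdentity_id.inversion (d := d) (fun _ => rfl) p).2⟩
  rw [invCount, ENat.card_eq_zero_iff_empty]
  infer_instance

theorem inversion_simpleReflection {k : ℕ} (hk : k ≠ 1) (d m : ℤ)
    (p : Inversion (shift d * simpleReflection k (m - 1))) :
    p.1.2 = p.1.1 + 1 ∧ (k : ℤ) ∣ p.1.2 - m :=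
  (isNearIdentity_simpleReflection hk m).inversion (shift_mul_apply d · _) p

/-- The inversion of a simple reflection at the position `n`. -/
def simpleInversion {k : ℕ} (hk : k ≠ 1) (d m n : ℤ) (hn : (k : ℤ) ∣ n - m) :
    Inversion (shift d * simpleReflection k (m - 1)) :=
  ⟨(n - 1, n), by
    have h1 := (isNearIdentity_simpleReflection hk m).down n hn
    have h2 := (isNearIdentity_simpleReflection hk m).up (n - 1) (by rwa [sub_add_cancel])
    simp only [shift_mul_apply] at h1 h2 ⊢
    omega⟩

theorem reflection_mem_extAffine {k : ℕ} (hk : k ≠ 1) (d m : ℤ) :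
    shift d * simpleReflection k (m - 1) ∈ extAffine k := by
  simp only [extAffine, Set.mem_ofPred_eq]
  split_ifs with h0
  · subst h0
    have : Subsingleton (Inversion (shift d * simpleReflection 0 (m - 1))) := by
      refine ⟨fun p q => Subtype.ext (Prod.ext ?_ ?_)⟩
      all_goals
        have hp := inversion_simpleReflection hk d m p
        have hq := inversion_simpleReflection hk d m q
        simp only [Nat.cast_zero, zero_dvd_iff] at hp hq
        omega
    infer_instance
  · intro n
    have h1 : (k : ℤ) ∣ n + k + 1 - m ↔ (k : ℤ) ∣ n + 1 - m := by
      rw [show n + k + 1 - m = n + 1 - m + k by ring, dvd_add_self_right]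
    have h2 : (k : ℤ) ∣ n + k - m ↔ (k : ℤ) ∣ n - m := by
      rw [show n + k - m = n - m + k by ring, dvd_add_self_right]
    rw [shift_mul_apply, shift_mul_apply, simpleReflection_apply, simpleReflection_apply]
    simp only [h1, h2]
    split_ifs <;> ring

theorem invCount_reflection_le {k : ℕ} (hk : k ≠ 1) (d m : ℤ) :
    invCount k (shift d * simpleReflection k (m - 1)) ≤ 1 := by
  rw [invCount, ENat.card_le_one_iff_subsingleton]
  refine ⟨fun x y => ?_⟩
  induction x using Quot.ind with | _ p => ?_
  induction y using Quot.ind with | _ q => ?_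
  apply Quot.sound
  have hp := inversion_simpleReflection hk d m p
  have hq := inversion_simpleReflection hk d m q
  obtain ⟨a, ha⟩ := hp.2
  obtain ⟨b, hb⟩ := hq.2
  have : (b - a) * (k : ℤ) = k * b - k * a := by ring
  exact ⟨b - a, by omega, by omega⟩

/-- The inversions ending at `m` and `m + j` lie in one class, which forces `k ∣ j`. For `k > 0`,
periodicity moves the exchange at `m` to `m + k`, which forces `j ∣ k`. -/
theorem eq_of_reflection_mem_extAffine {j k : ℕ} (hj : j ≠ 1) (d m : ℤ)
    (h : shift d * simpleReflection j (m - 1) ∈ extAffine k)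
    (hinv : invCount k (shift d * simpleReflection j (m - 1)) ≤ 1) : j = k := by
  have hkj : (k : ℤ) ∣ j := by
    rw [invCount, ENat.card_le_one_iff_subsingleton] at hinv
    -- `Quot` identifies along the generated equivalence, so divisibility by `k` is carried along
    -- chains of translations.
    have := Quot.eqvGen_exact (hinv.elim (Quot.mk _ (simpleInversion hj d m m (by simp)))
      (Quot.mk _ (simpleInversion hj d m (m + j) (by simp))))
    have hdvd : ∀ p q : Inversion (shift d * simpleReflection j (m - 1)),
        Relation.EqvGen (fun p q => ∃ n : ℤ, q.1.1 = p.1.1 + n * k ∧ q.1.2 = p.1.2 + n * k) p q →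
          (k : ℤ) ∣ q.1.2 - p.1.2 := by
      intro p q hpq
      induction hpq with
      | rel _ _ h => obtain ⟨n, -, h⟩ := h; rw [h]; exact ⟨n, by ring⟩
      | refl => simp
      | symm _ _ _ ih => rw [← neg_sub]; exact (dvd_neg).2 ih
      | trans _ _ _ _ _ ih ih' => simpa using dvd_add ih ih'
    simpa [simpleInversion] using hdvd _ _ this
  rcases Nat.eq_zero_or_pos k with rfl | hpos
  · simpa using hkj
  · simp only [extAffine, Set.mem_ofPred_eq, if_neg hpos.ne'] at h
    have hm := h m
    rw [shift_mul_apply, shift_mul_apply,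
      (isNearIdentity_simpleReflection hj m).down m (by simp)] at hm
    have hjk : (j : ℤ) ∣ k := by
      by_contra hn
      have : simpleReflection j (m - 1) (m + k) = m + k - 1 := by linarith
      rw [simpleReflection_apply, if_neg (c := (j : ℤ) ∣ m + k - m) (by simpa using hn)] at this
      split_ifs at this <;> omega
    exact Nat.dvd_antisymm (by exact_mod_cast hjk) (by exact_mod_cast hkj)

namespace FinOrMetricGraph

variable (Γ : FinOrMetricGraph.{u})

/-! ### Linear equivalence on graphs of genus one -/

/-- The group of principal divisors. -/
def principal : (Γ : FinOrMetricGraph.{u}) → AddSubgroup Γ.Divisor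
  | finite G => G.principal
  | metric Γ => Γ.principal

theorem linEquiv_iff {Γ : FinOrMetricGraph.{u}} {D D' : Γ.Divisor} :
    Γ.LinEquiv D D' ↔ D - D' ∈ Γ.principal := by
  cases Γ <;> rfl

theorem deg_eq_zero_of_mem_principal {Γ : FinOrMetricGraph.{u}} {D : Γ.Divisor}
    (h : D ∈ Γ.principal) : Γ.deg D = 0 := by
  cases Γ with
  | finite G => exact G.degree_eq_zero_of_isPrincipal h
  | metric Γ => exact Γ.degree_eq_zero_of_isPrincipal h

theorem exists_linEquiv_pt (hg : Γ.genus = 1) (D : Γ.Divisor) (hD : Γ.deg D = 1) :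
    ∃ z, Γ.LinEquiv D (Γ.pt z) := by
  simp only [linEquiv_iff]
  cases Γ with
  | finite G =>
    exact G.edgeModel.exists_point_of_degree_one
      (by simp only [genus, Multigraph.genus] at hg; omega) D hD
  | metric Γ =>
    exact Γ.edgeModel.exists_point_of_degree_one
      (by simp only [genus, Multigraph.genus] at hg; omega) D hD

theorem canonical_mem_principal (hg : Γ.genus = 1) : Γ.canonical ∈ Γ.principal := by
  cases Γ with
  | finite G =>
    exact G.edgeModel.canonical_mem_prin
      (by simp only [genus, Multigraph.genus] at hg; omega)
  | metric Γ =>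
    exact Γ.edgeModel.canonical_mem_prin
      (by simp only [genus, Multigraph.genus] at hg; omega)

variable {Γ}

theorem LinEquiv.symm {D D' : Γ.Divisor} (h : Γ.LinEquiv D D') : Γ.LinEquiv D' D := by
  rw [linEquiv_iff] at h ⊢
  simpa using Γ.principal.neg_mem h

theorem LinEquiv.trans {D D' D'' : Γ.Divisor} (h : Γ.LinEquiv D D') (h' : Γ.LinEquiv D' D'') :
    Γ.LinEquiv D D'' := by
  rw [linEquiv_iff] at h h' ⊢
  simpa using Γ.principal.add_mem h h'

theorem linEquiv_congr {D D' F F' : Γ.Divisor} (h : Γ.LinEquiv D D') (e : D - D' = F - F') :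
    Γ.LinEquiv F F' := by
  rwa [linEquiv_iff, ← e, ← linEquiv_iff]

theorem deg_add (D D' : Γ.Divisor) : Γ.deg (D + D') = Γ.deg D + Γ.deg D' :=
  Finsupp.sum_add_index' (fun _ => rfl) (fun _ _ _ => rfl)

variable (Γ) in
/-- The degree as a homomorphism. -/
def degHom : Γ.Divisor →+ ℤ := AddMonoidHom.mk' Γ.deg deg_add

theorem deg_sub (D D' : Γ.Divisor) : Γ.deg (D - D') = Γ.deg D - Γ.deg D' :=
  map_sub Γ.degHom D D'

theorem deg_zsmul_pt (n : ℤ) (p : Γ.Point) : Γ.deg (n • Γ.pt p) = n := by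
  have h : Γ.deg (Γ.pt p) = 1 := Finsupp.sum_single_index rfl
  have := map_zsmul Γ.degHom n (Γ.pt p)
  change Γ.deg _ = n • Γ.deg _ at this
  rw [this, h, smul_eq_mul, mul_one]

theorem deg_pt (p : Γ.Point) : Γ.deg (Γ.pt p) = 1 := Finsupp.sum_single_index rfl

theorem LinEquiv.deg_eq {D D' : Γ.Divisor} (h : Γ.LinEquiv D D') : Γ.deg D = Γ.deg D' := by
  have := deg_eq_zero_of_mem_principal (linEquiv_iff.1 h)
  rwa [deg_sub, sub_eq_zero] at this

theorem deg_nonneg {F : Γ.Divisor} (hF : 0 ≤ F) : 0 ≤ Γ.deg F :=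
  Finset.sum_nonneg fun p _ => hF p

theorem eq_zero_of_deg_eq_zero {F : Γ.Divisor} (hF : 0 ≤ F) (h : Γ.deg F = 0) : F = 0 := by
  ext p
  by_contra hp
  exact hp ((Finset.sum_eq_zero_iff_of_nonneg fun p _ => hF p).1 h p (Finsupp.mem_support_iff.2 hp))

theorem zsmul_pt_nonneg {n : ℤ} (hn : 0 ≤ n) (p : Γ.Point) : 0 ≤ n • Γ.pt p :=
  zsmul_nonneg (Finsupp.single_nonneg.2 zero_le_one) hn

/-! ### Ranks of divisors on graphs of genus one -/

/-- The rank on a graph of genus one with two inequivalent points. -/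
theorem rank_add_one (hg : Γ.genus = 1) {v w : Γ.Point} (hvw : ¬ Γ.LinEquiv (Γ.pt v) (Γ.pt w))
    (D : Γ.Divisor) :
    Γ.rank D + 1 = if Γ.LinEquiv D 0 then 1 else max (Γ.deg D) 0 := by
  -- If `r ≥ deg D`, effectivity forces `D - E ∼ 0` for all effective `E` of degree `r`. For `r >
  -- 0`, the choices `r v` and `(r - 1) v + w` would then give `v ∼ w`.
  have upper : ∀ r : ℤ, 0 ≤ r → (∀ E : Γ.Divisor, 0 ≤ E → Γ.deg E = r →
      ∃ F : Γ.Divisor, 0 ≤ F ∧ Γ.LinEquiv (D - E) F) →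
      r < Γ.deg D ∨ (r = 0 ∧ Γ.LinEquiv D 0) := by
    intro r hr h
    rcases lt_or_ge r (Γ.deg D) with hlt | hge
    · exact Or.inl hlt
    · right
      have hzero : ∀ E : Γ.Divisor, 0 ≤ E → Γ.deg E = r → Γ.LinEquiv (D - E) 0 := by
        intro E hE hEr
        obtain ⟨F, hF, hDF⟩ := h E hE hEr
        have hdeg := hDF.deg_eq
        rw [deg_sub, hEr] at hdeg
        have hF0 := deg_nonneg hF
        rw [eq_zero_of_deg_eq_zero hF (by omega)] at hDF
        exact hDF
      rcases hr.eq_or_lt with rfl | hpos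
      · exact ⟨rfl, by simpa using hzero 0 le_rfl (map_zero Γ.degHom)⟩
      · exfalso
        have h1 := hzero (r • Γ.pt v) (zsmul_pt_nonneg hr v) (deg_zsmul_pt r v)
        have h2 := hzero ((r - 1) • Γ.pt v + Γ.pt w)
          (add_nonneg (zsmul_pt_nonneg (by omega) v) (Finsupp.single_nonneg.2 zero_le_one))
          (by rw [deg_add, deg_zsmul_pt, deg_pt]; ring)
        refine hvw (linEquiv_congr (h2.trans h1.symm) ?_)
        rw [sub_smul, one_smul]
        abel
  have key : ∀ r : ℤ, IsGreatest {r : ℤ | -1 ≤ r ∧ ∀ E : Γ.Divisor, 0 ≤ E → Γ.deg E = r →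
      ∃ F : Γ.Divisor, 0 ≤ F ∧ Γ.LinEquiv (D - E) F} r → Γ.rank D = r :=
    fun r h => h.csSup_eq
  split_ifs with h0
  · have hdeg : Γ.deg D = 0 := h0.deg_eq.trans (map_zero Γ.degHom)
    rw [key 0 ⟨⟨by norm_num, fun E hE hEr => ⟨0, le_rfl, ?_⟩⟩, fun r hr => ?_⟩, zero_add]
    · rwa [eq_zero_of_deg_eq_zero hE hEr, sub_zero]
    · by_contra hc
      rcases upper r (by omega) hr.2 with h | h <;> omega
  · rcases le_or_gt (Γ.deg D) 0 with hd | hd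
    · rw [key (-1) ⟨⟨le_rfl, fun E hE hEr => ?_⟩, fun r hr => ?_⟩, max_eq_right hd]
      · norm_num
      · exact absurd (deg_nonneg hE) (by omega)
      · by_contra hc
        rcases upper r (by omega) hr.2 with h | h
        · omega
        · exact h0 h.2
    · rw [key (Γ.deg D - 1) ⟨⟨by omega, fun E hE hEr => ?_⟩, fun r hr => ?_⟩, max_eq_left hd.le,
        sub_add_cancel]
      -- The lower bound for positive degree: `D - E` has degree one and hence is equivalent to a
      -- point.
      · obtain ⟨z, hz⟩ := Γ.exists_linEquiv_pt hg (D - E) (by rw [deg_sub, hEr]; ring)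
        exact ⟨Γ.pt z, Finsupp.single_nonneg.2 zero_le_one, hz⟩
      · by_contra hc
        rcases upper r (by omega) hr.2 with h | h
        · omega
        · exact h0 h.2

theorem deg_twist (v w : Γ.Point) (D : Γ.Divisor) (a b : ℤ) :
    Γ.deg (D + a • Γ.pt v - b • Γ.pt w) = Γ.deg D + a - b := by
  rw [deg_sub, deg_add, deg_zsmul_pt, deg_zsmul_pt]

/-- The second difference of `max d 0` is `1` at `d = 1` and `0` elsewhere. Triviality of `D' - v`
or `D' - w` costs `1`, but needs `deg D' = 1`, and both cannot occur since `v ≁ w`. -/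
theorem isSubmodular (hg : Γ.genus = 1) {v w : Γ.Point}
    (hvw : ¬ Γ.LinEquiv (Γ.pt v) (Γ.pt w)) (D : Γ.Divisor) : Γ.IsSubmodular v w D := by
  intro a b
  generalize D + a • Γ.pt v - b • Γ.pt w = D'
  have h1 := rank_add_one hg hvw D'
  have h2 := rank_add_one hg hvw (D' - Γ.pt v)
  have h3 := rank_add_one hg hvw (D' - Γ.pt w)
  have h4 := rank_add_one hg hvw (D' - Γ.pt v - Γ.pt w)
  have hz : ∀ F : Γ.Divisor, Γ.LinEquiv F 0 → Γ.deg F = 0 := fun F h =>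
    h.deg_eq.trans (map_zero Γ.degHom)
  have e2 := hz (D' - Γ.pt v)
  have e3 := hz (D' - Γ.pt w)
  have hne : Γ.LinEquiv (D' - Γ.pt v) 0 → Γ.LinEquiv (D' - Γ.pt w) 0 → False := by
    intro h h'
    refine hvw (linEquiv_congr (h'.trans h.symm) ?_)
    abel
  rw [deg_sub, deg_pt] at h2 h3 e2 e3
  rw [deg_sub, deg_sub, deg_pt, deg_pt] at h4
  rw [Delta]
  have e1 := hz D'
  have e4 := hz (D' - Γ.pt v - Γ.pt w)
  rw [deg_sub, deg_sub, deg_pt, deg_pt] at e4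
  by_cases c2 : Γ.LinEquiv (D' - Γ.pt v) 0
  · have c3 : ¬ Γ.LinEquiv (D' - Γ.pt w) 0 := hne c2
    have := e2 c2
    rw [if_pos c2] at h2
    rw [if_neg c3] at h3
    rw [if_neg (fun c => by have := e1 c; omega)] at h1
    rw [if_neg (fun c => by have := e4 c; omega)] at h4
    omega
  · rw [if_neg c2] at h2
    by_cases c3 : Γ.LinEquiv (D' - Γ.pt w) 0
    · have := e3 c3
      rw [if_pos c3] at h3
      rw [if_neg (fun c => by have := e1 c; omega)] at h1
      rw [if_neg (fun c => by have := e4 c; omega)] at h4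
      omega
    · rw [if_neg c3] at h3
      split_ifs at h1 with c1
      · have := e1 c1
        split_ifs at h4 <;> omega
      · split_ifs at h4 with c4
        · have := e4 c4
          omega
        · omega

/-! ### Transmission permutations on graphs of genus one -/

theorem IsTransmissionPerm.unique {v w : Γ.Point} {D : Γ.Divisor} {τ τ' : Equiv.Perm ℤ}
    (h : Γ.IsTransmissionPerm v w D τ) (h' : Γ.IsTransmissionPerm v w D τ') : τ = τ' :=
  perm_eq_of_ncard_eq fun a b => ⟨(h a b).1.1, (h' a b).1.1, by
    exact_mod_cast (h a b).1.2.symm.trans (h' a b).1.2⟩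

/-- With threshold `A = a + deg D - 1`, the regular count `A + 1 - b` is the degree of the twist,
and the exceptional case `A = b - 1` with `e b` is the twist being trivial. As `K ∼ 0`, the dual
divisor is trivial in the same case. -/
theorem isTransmissionPerm_of_isNearIdentity (hg : Γ.genus = 1) {v w : Γ.Point}
    (hvw : ¬ Γ.LinEquiv (Γ.pt v) (Γ.pt w)) {D : Γ.Divisor} {τ : Equiv.Perm ℤ} {s : ℤ → ℤ}
    {e : ℤ → Prop} (hs : IsNearIdentity s e) (hτ : ∀ n, τ n = s n - (Γ.deg D - 1))
    (he : ∀ b, Γ.LinEquiv D (b • Γ.pt w + (Γ.deg D - b) • Γ.pt v) ↔ e b) :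
    Γ.IsTransmissionPerm v w D τ := by
  intro a b
  have hE : Γ.LinEquiv (D + a • Γ.pt v - b • Γ.pt w) 0 ↔ (a + (Γ.deg D - 1) = b - 1 ∧ e b) := by
    rw [← he]
    constructor
    · intro h
      have hd := h.deg_eq.trans (map_zero Γ.degHom)
      rw [deg_twist] at hd
      refine ⟨by omega, linEquiv_congr h ?_⟩
      rw [show Γ.deg D - b = -a by omega, neg_smul]
      abel
    · rintro ⟨hd, h⟩
      refine linEquiv_congr h ?_
      rw [show Γ.deg D - b = -a by omega, neg_smul]
      abel
  have hK : Γ.LinEquiv (Γ.canonical - D - a • Γ.pt v + b • Γ.pt w) 0 ↔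
      Γ.LinEquiv (D + a • Γ.pt v - b • Γ.pt w) 0 := by
    have hKp := Γ.canonical_mem_principal hg
    have hadd : (Γ.canonical - D - a • Γ.pt v + b • Γ.pt w - 0) +
        (D + a • Γ.pt v - b • Γ.pt w - 0) = Γ.canonical := by abel
    rw [linEquiv_iff, linEquiv_iff]
    rw [← hadd] at hKp
    constructor
    · intro h
      exact (Γ.principal.add_mem_cancel_left h).1 hKp
    · intro h
      exact (Γ.principal.add_mem_cancel_right h).1 hKp
  have hKd : Γ.deg (Γ.canonical - D - a • Γ.pt v + b • Γ.pt w) = b - Γ.deg D - a := by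
    rw [deg_add, deg_sub, deg_sub, deg_zsmul_pt, deg_zsmul_pt,
      deg_eq_zero_of_mem_principal (Γ.canonical_mem_principal hg)]
    ring
  have hge := hs.count_ge (a + (Γ.deg D - 1)) b
  have hlt := hs.count_lt (a + (Γ.deg D - 1)) b
  have s1 : {n : ℤ | b ≤ n ∧ τ n ≤ a} = {n : ℤ | b ≤ n ∧ s n ≤ a + (Γ.deg D - 1)} := by
    simp only [hτ, sub_le_iff_le_add]
  have s2 : {n : ℤ | n < b ∧ a < τ n} = {n : ℤ | n < b ∧ a + (Γ.deg D - 1) < s n} := by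
    simp only [hτ, lt_sub_iff_add_lt]
  rw [s1, s2, rank_add_one hg hvw, rank_add_one hg hvw, hge.2, hlt.2, hKd, deg_twist]
  simp only [hK, hE]
  refine ⟨⟨hge.1, ?_⟩, hlt.1, ?_⟩
  · congr 2; ring
  · congr 2; ring

theorem isTransmissionPerm_shift (hg : Γ.genus = 1) {v w : Γ.Point}
    (hvw : ¬ Γ.LinEquiv (Γ.pt v) (Γ.pt w)) {D : Γ.Divisor}
    (hD : ¬ ∃ m : ℤ, Γ.LinEquiv D (m • Γ.pt w + (Γ.deg D - m) • Γ.pt v)) :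
    Γ.IsTransmissionPerm v w D (shift (Γ.deg D - 1)) :=
  isTransmissionPerm_of_isNearIdentity hg hvw isNearIdentity_id (fun _ => rfl)
    fun b => ⟨fun h => hD ⟨b, h⟩, False.elim⟩

theorem IsTorsionOrder.ne_one {v w : Γ.Point} (hvw : ¬ Γ.LinEquiv (Γ.pt v) (Γ.pt w)) {k : ℕ}
    (hk : Γ.IsTorsionOrder v w k) : k ≠ 1 := by
  rintro rfl
  exact hvw (by simpa using (hk 1).2 (by simp))

/-- Two representations of `D`, with `m` and with `b`, differ by `(b - m)(v - w)`, so the exchanged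
positions form the residue class of `m` modulo `k`. -/
theorem isTransmissionPerm_reflection (hg : Γ.genus = 1) {v w : Γ.Point}
    (hvw : ¬ Γ.LinEquiv (Γ.pt v) (Γ.pt w)) {k : ℕ} (hk : Γ.IsTorsionOrder v w k) {D : Γ.Divisor}
    {m : ℤ} (hD : Γ.LinEquiv D (m • Γ.pt w + (Γ.deg D - m) • Γ.pt v)) :
    Γ.IsTransmissionPerm v w D (shift (Γ.deg D - 1) * simpleReflection k (m - 1)) := by
  refine isTransmissionPerm_of_isNearIdentity hg hvw
    (isNearIdentity_simpleReflection (hk.ne_one hvw) m) (fun _ => rfl) fun b => ?_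
  rw [← hk]
  have hdiff : m • Γ.pt w + (Γ.deg D - m) • Γ.pt v - (b • Γ.pt w + (Γ.deg D - b) • Γ.pt v) =
      (b - m) • Γ.pt v - (b - m) • Γ.pt w := by
    simp only [sub_smul]
    abel
  exact ⟨fun h => linEquiv_congr (hD.symm.trans h) hdiff,
    fun h => hD.trans (linEquiv_congr h hdiff.symm)⟩

theorem exists_isTorsionOrder (v w : Γ.Point) : ∃ k, Γ.IsTorsionOrder v w k := by
  let H : AddSubgroup ℤ := Γ.principal.comap (zmultiplesHom _ (Γ.pt v - Γ.pt w))
  obtain ⟨a, ha⟩ := Int.subgroup_cyclic H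
  refine ⟨a.natAbs, fun n => ?_⟩
  have : Γ.LinEquiv (n • Γ.pt v) (n • Γ.pt w) ↔ n ∈ H := by
    rw [linEquiv_iff, ← smul_sub]
    rfl
  rw [this, ha, Int.natAbs_dvd, ← AddSubgroup.zmultiples_eq_closure, Int.mem_zmultiples_iff]

theorem hasGeneralTransmission_of_isTorsionOrder (hg : Γ.genus = 1) {v w : Γ.Point}
    (hvw : ¬ Γ.LinEquiv (Γ.pt v) (Γ.pt w)) {k : ℕ} (hk : Γ.IsTorsionOrder v w k) :
    Γ.HasGeneralTransmission v w k := by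
  intro D
  refine ⟨isSubmodular hg hvw D, ?_⟩
  rw [hg, Nat.cast_one]
  by_cases hD : ∃ m : ℤ, Γ.LinEquiv D (m • Γ.pt w + (Γ.deg D - m) • Γ.pt v)
  · obtain ⟨m, hm⟩ := hD
    exact ⟨_, isTransmissionPerm_reflection hg hvw hk hm,
      reflection_mem_extAffine (hk.ne_one hvw) _ _, invCount_reflection_le (hk.ne_one hvw) _ _⟩
  · exact ⟨_, isTransmissionPerm_shift hg hvw hD, shift_mem_extAffine _ _,
      by rw [invCount_shift]; exact zero_le_one⟩

/-- It suffices to test `D = 0`: with `j` the actual torsion order, its transmission permutation is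
a shifted reflection of period `j`, and the two conditions for `k` force `j = k`. -/
theorem isTorsionOrder_of_hasGeneralTransmission (hg : Γ.genus = 1) {v w : Γ.Point}
    (hvw : ¬ Γ.LinEquiv (Γ.pt v) (Γ.pt w)) {k : ℕ}
    (h : Γ.HasGeneralTransmission v w k) : Γ.IsTorsionOrder v w k := by
  obtain ⟨j, hj⟩ := Γ.exists_isTorsionOrder v w
  obtain ⟨-, τ, hτ, hmem, hinv⟩ := h 0
  have hdeg : Γ.deg 0 = 0 := map_zero Γ.degHom
  have hτ' := isTransmissionPerm_reflection hg hvw hj (D := 0) (m := 0) (by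
    rw [linEquiv_iff]
    simp [hdeg, Γ.principal.zero_mem])
  rw [hτ.unique hτ'] at hmem hinv
  rw [hg, Nat.cast_one] at hinv
  rwa [← eq_of_reflection_mem_extAffine (hj.ne_one hvw) _ _ hmem hinv]

end FinOrMetricGraph

end Transmission

end

theorem mainTheorem7 (Γ : Transmission.FinOrMetricGraph.{u}) (hg : Γ.genus = 1)
    (v w : Γ.Point) (hvw : ¬ Γ.LinEquiv (Γ.pt v) (Γ.pt w)) :
    (∀ k : ℕ, Γ.IsTorsionOrder v w k →
      ∀ (d : ℤ) (D : Γ.Divisor), Γ.deg D = d →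
        Γ.IsSubmodular v w D ∧
        (∀ m : ℤ, Γ.LinEquiv D (m • Γ.pt w + (d - m) • Γ.pt v) →
          ∀ τ : Equiv.Perm ℤ, Γ.IsTransmissionPerm v w D τ ↔
            τ = Transmission.shift (d - 1) * Transmission.simpleReflection k (m - 1)) ∧
        ((¬ ∃ m : ℤ, Γ.LinEquiv D (m • Γ.pt w + (d - m) • Γ.pt v)) →
          ∀ τ : Equiv.Perm ℤ, Γ.IsTransmissionPerm v w D τ ↔
            τ = Transmission.shift (d - 1))) ∧
    (∀ k : ℕ, k ≠ 1 →
      (Γ.HasGeneralTransmission v w k ↔ Γ.IsTorsionOrder v w k)) := by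
  refine ⟨fun k hk d D hd => ?_, fun k _ =>
    ⟨Transmission.FinOrMetricGraph.isTorsionOrder_of_hasGeneralTransmission hg hvw,
      Transmission.FinOrMetricGraph.hasGeneralTransmission_of_isTorsionOrder hg hvw⟩⟩
  subst hd
  refine ⟨Transmission.FinOrMetricGraph.isSubmodular hg hvw D, fun m hm τ => ?_, fun hD τ => ?_⟩
  · have h := Transmission.FinOrMetricGraph.isTransmissionPerm_reflection hg hvw hk hm
    exact ⟨fun hτ => hτ.unique h, fun hτ => hτ ▸ h⟩
  · have h := Transmission.FinOrMetricGraph.isTransmissionPerm_shift hg hvw hD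
    exact ⟨fun hτ => hτ.unique h, fun hτ => hτ ▸ h⟩
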